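/- Let $\mathscr C$ be a category with finite limits and $\mathscr P$ a projective class in $\mathscr C$, i.e. a class of objects such that every object $C$ admits a $\mathscr P$-epimorphism $Q\to C$ with $Q\in\mathscr P$, where $f\colon X\to Y$ is a $\mathscr P$-epimorphism if $\operatorname{Hom}_{\mathscr C}(Q,X)\to\operatorname{Hom}_{\mathscr C}(Q,Y)$ is surjective for all $Q\in\mathscr P$. Let $\mathscr B$ be an abelian category. *Pseudocubical resolutions.* A pseudocubical object $X$ consists of objects $X_n$ ($n\ge 0$), faces $\partial_i^0,\partial_i^1\colon X_n\to X_{n-1}$ and pseudodegeneracies $s_i\colon X_{n-1}\to X_n$ ($1\le i\le n$) such that $\partial_i^\alpha\partial_j^\varepsilon=\partial_{j-1}^\varepsilon\partial_i^\alpha$ for $i<j$, and $\partial_i^\alpha s_j$ equals $s_{j-1}\partial_i^\alpha$ if $i<j$, $\mathrm{id}$ if $i=j$, $s_j\partial_{i-1}^\alpha$ if $i>j$. A $\mathscr P$-projective pseudocubical resolution $X\to C$ is a pseudocubical object $X$ in $\mathscr C$ with all $X_n\in\mathscr P$ and a morphism $\partial\colon X_0\to C$ with $\partial\partial_1^0=\partial\partial_1^1$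 that is $\mathscr P$-exact: $\partial\colon X_0\to C$, $(\partial_1^0,\partial_1^1)\colon X_1\to X_0\times_C X_0$ and, for all $n\ge1$, the canonical morphism from $X_{n+1}$ to the cubical kernel of the faces $X_n\to X_{n-1}$ are $\mathscr P$-epimorphisms. Here the cubical kernel is the universal object $K$ with morphisms $k_i^\varepsilon\colon K\to X_n$ ($1\le i\le n+1$, $\varepsilon\in\{0,1\}$) satisfying $\partial_i^\alpha k_j^\varepsilon=\partial_{j-1}^\varepsilon k_i^\alpha$ for $i<j$. *Normalization.* For a pseudocubical object $X$ in an idempotent complete preadditive category, let $C(X)$ be the chain complex with $C(X)_n=X_n$ and $\partial=\sum_{i=1}^n(-1)^i(\partial_i^1-\partial_i^0)$. The morphisms $\sigma_n=(1-s_1\partial_1^1)\cdots(1-s_n\partial_n^1)$ form an idempotent chain endomorphism $\sigma$ of $C(X)$, and the normalized chain complex is $N(X)=\operatorname{Ker}(1-\sigma)$. For $F\colon\mathscr C\to\mathscr B$ the cubical derived functors $\mathbf L^{\Box}_nF\colon\mathscr C\to\mathscr B$ are defined by $\mathbf L^{\Box}_nF(C)=H_n(N(F(X)))$, where $X\to C$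 is a chosen $\mathscr P$-projective pseudocubical resolution; on morphisms they are induced by morphisms of resolutions compatible with the faces and augmentations. *Relative derived functors.* Let $\mathscr A$ be a preadditive category and $\mathscr Q$ a class of its objects. A $\mathscr Q$-resolution of $A\in\mathscr A$ is an augmented chain complex $\cdots\to P_1\to P_0\to A$ with all $P_n\in\mathscr Q$ such that $\cdots\to\operatorname{Hom}(Q,P_1)\to\operatorname{Hom}(Q,P_0)\to\operatorname{Hom}(Q,A)\to0$ is exact for all $Q\in\mathscr Q$. For an additive functor $G\colon\mathscr A\to\mathscr B$, the functors $\mathbf L^{\mathscr Q}_nG$ are defined on the full subcategory of the objects possessing a $\mathscr Q$-resolution by $\mathbf L^{\mathscr Q}_nG(A)=H_n(G(P_*))$, where $P_*\to A$ is a chosen $\mathscr Q$-resolution; on morphisms they are induced by chain maps of resolutions. The closure $\overline{\mathscr Q}$ consists of all objects $Q$ of $\mathscr A$ such that $\operatorname{Hom}(Q,X)\to\operatorname{Hom}(Q,Y)\to\operatorname{Hom}(Q,Z)$ is exact whenever $X\to Y\to Z$ is a sequence with zero composite for which the corresponding sequences with $Q$ replaced by any object of $\mathscr Q$ are exact. Let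 $\mathbb Z\mathscr C$ be the free preadditive category generated by $\mathscr C$, let $\widetilde{\mathbb Z\mathscr C}$ be its idempotent completion, and for a functor $F\colon\mathscr C\to\mathscr B$ let $F_{ad}\colon\mathbb Z\mathscr C\to\mathscr B$ be its unique additive extension. Regard $\mathscr P$ also as a class of objects of $\mathbb Z\mathscr C$ and of $\widetilde{\mathbb Z\mathscr C}$. Then: (i) For every object $C$ of $\mathscr C$ and every $\mathscr P$-projective pseudocubical resolution $X\to C$, the augmented chain complex $N(X)\to C$ in $\widetilde{\mathbb Z\mathscr C}$ is a $\overline{\mathscr P}$-resolution of $C$, where $\overline{\mathscr P}$ is the closure of $\mathscr P$ in $\widetilde{\mathbb Z\mathscr C}$. (ii) Every object $C$ of $\mathscr C$ has a $\mathscr P$-projective pseudocubical resolution in $\mathscr C$ and possesses a $\mathscr P$-resolution in $\mathbb Z\mathscr C$; and for all choices of resolutions in the definitions of $\mathbf L^{\Box}_n$ and $\mathbf L^{\mathscr P}_n$ and all $n\ge0$ there is an isomorphism $$\mathbf L^{\Box}_nF(C)\cong\mathbf L^{\mathscr P}_nF_{ad}(C),$$ natural in $C\in\mathscr C$ and in $F\colon\mathscr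 C\to\mathscr B$. -/

import Mathlib

open CategoryTheory CategoryTheory.Limits

noncomputable section

namespace CubicalDerived

universe v u v' u'

/-! ## Projective classes -/

section ProjectiveClass

variable {C : Type u} [Category.{v} C]

/-- A morphism `f : X ⟶ Y` is a `P`-epimorphism if every morphism from an object of `P` to `Y`
factors through `f`. -/
def IsPEpi (P : ObjectProperty C) {X Y : C} (f : X ⟶ Y) : Prop :=
  ∀ Q, P Q → Function.Surjective (fun x : Q ⟶ X => x ≫ f)

/-- `P` is a projective class: every object is the target of a `P`-epimorphism whose source
lies in `P`. -/
def IsProjectiveClass (P : ObjectProperty C) : Prop :=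
  ∀ Y : C, ∃ (Q : C) (f : Q ⟶ Y), P Q ∧ IsPEpi P f

end ProjectiveClass

/-! ## Pseudocubical objects -/

/-- A pseudocubical object. Indices are shifted to start at `0`: `d n i false` and `d n i true`
are the face operators `∂_{i+1}^0, ∂_{i+1}^1 : X_{n+1} ⟶ X_n`, and `s n i` is the
pseudodegeneracy `s_{i+1} : X_n ⟶ X_{n+1}`. -/
structure PseudocubicalObject (C : Type u) [Category.{v} C] where
  X : ℕ → C
  d : ∀ n : ℕ, Fin (n + 1) → Bool → (X (n + 1) ⟶ X n)
  s : ∀ n : ℕ, Fin (n + 1) → (X n ⟶ X (n + 1))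
  d_d : ∀ (n : ℕ) (i j : Fin (n + 1)) (a e : Bool), i ≤ j →
    d (n + 1) j.succ e ≫ d n i a = d (n + 1) i.castSucc a ≫ d n j e
  s_d_lt : ∀ (n : ℕ) (i j : Fin (n + 1)) (a : Bool), i ≤ j →
    s (n + 1) j.succ ≫ d (n + 1) i.castSucc a = d n i a ≫ s n j
  s_d_self : ∀ (n : ℕ) (i : Fin (n + 1)) (a : Bool), s n i ≫ d n i a = 𝟙 (X n)
  s_d_gt : ∀ (n : ℕ) (i j : Fin (n + 1)) (a : Bool), j ≤ i →
    s (n + 1) j.castSucc ≫ d (n + 1) i.succ a = d n i a ≫ s n j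

namespace PseudocubicalObject

section Basic

variable {C : Type u} [Category.{v} C] {D : Type u'} [Category.{v'} D]

/-- The image of a pseudocubical object under a functor. -/
def map (F : C ⥤ D) (X : PseudocubicalObject C) : PseudocubicalObject D where
  X n := F.obj (X.X n)
  d n i a := F.map (X.d n i a)
  s n i := F.map (X.s n i)
  d_d n i j a e h := by rw [← F.map_comp, ← F.map_comp, X.d_d n i j a e h]
  s_d_lt n i j a h := by rw [← F.map_comp, ← F.map_comp, X.s_d_lt n i j a h]
  s_d_self n i a := by rw [← F.map_comp, X.s_d_self, F.map_id]
  s_d_gt n i j a h := by rw [← F.map_comp, ← F.map_comp, X.s_d_gt n i j a h]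

/-- A precubical morphism: a family of morphisms compatible with the face operators
(but not necessarily with the pseudodegeneracies). -/
@[ext]
structure PreHom (X Y : PseudocubicalObject C) where
  f : ∀ n : ℕ, X.X n ⟶ Y.X n
  comm : ∀ (n : ℕ) (i : Fin (n + 1)) (a : Bool), f (n + 1) ≫ Y.d n i a = X.d n i a ≫ f n

/-- The identity precubical morphism. -/
def PreHom.id (X : PseudocubicalObject C) : PreHom X X where
  f n := 𝟙 _
  comm n i a := by simp

/-- The composition of precubical morphisms. -/
def PreHom.comp {X Y Z : PseudocubicalObject C} (φ : PreHom X Y) (ψ : PreHom Y Z) :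
    PreHom X Z where
  f n := φ.f n ≫ ψ.f n
  comm n i a := by rw [Category.assoc, ψ.comm, ← Category.assoc, φ.comm, Category.assoc]

/-- The image of a precubical morphism under a functor. -/
def PreHom.map (F : C ⥤ D) {X Y : PseudocubicalObject C} (φ : PreHom X Y) :
    PreHom (X.map F) (Y.map F) where
  f n := F.map (φ.f n)
  comm n i a := by
    change F.map _ ≫ F.map _ = F.map _ ≫ F.map _
    rw [← F.map_comp, ← F.map_comp, φ.comm]

/-- The precubical morphism induced by a natural transformation. -/
def PreHom.ofNatTrans {F G : C ⥤ D} (α : F ⟶ G) (X : PseudocubicalObject C) :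
    PreHom (X.map F) (X.map G) where
  f n := α.app (X.X n)
  comm _ _ _ := (α.naturality _).symm

/-- A precubical homotopy between precubical morphisms `φ` and `ψ`. -/
structure PreHomotopy {X Y : PseudocubicalObject C} (φ ψ : PreHom X Y) where
  h : ∀ n : ℕ, X.X n ⟶ Y.X (n + 1)
  h_zero_false : ∀ n, h n ≫ Y.d n 0 false = φ.f n
  h_zero_true : ∀ n, h n ≫ Y.d n 0 true = ψ.f n
  h_succ : ∀ (n : ℕ) (i : Fin (n + 1)) (a : Bool),
    h (n + 1) ≫ Y.d (n + 1) i.succ a = X.d n i a ≫ h n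

/-- The image of a precubical homotopy under a functor. -/
def PreHomotopy.map (F : C ⥤ D) {X Y : PseudocubicalObject C} {φ ψ : PreHom X Y}
    (H : PreHomotopy φ ψ) : PreHomotopy (φ.map F) (ψ.map F) where
  h n := F.map (H.h n)
  h_zero_false n := by
    change F.map _ ≫ F.map _ = F.map _
    rw [← F.map_comp, H.h_zero_false]
  h_zero_true n := by
    change F.map _ ≫ F.map _ = F.map _
    rw [← F.map_comp, H.h_zero_true]
  h_succ n i a := by
    change F.map _ ≫ F.map _ = F.map _ ≫ F.map _
    rw [← F.map_comp, ← F.map_comp, H.h_succ]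

end Basic

/-! ## The normalized chain complex -/

section Normalization

variable {D : Type u} [Category.{v} D] [Preadditive D] (X : PseudocubicalObject D)

/-- The differential `∑_{i=1}^{n+1} (-1)^i (∂_i^1 - ∂_i^0)` of the unnormalized chain complex
`C(X)`, where `C(X)_n = X_n` (with `i` shifted by one). -/
def objD (n : ℕ) : X.X (n + 1) ⟶ X.X n :=
  ∑ i : Fin (n + 1), (-1 : ℤ) ^ ((i : ℕ) + 1) • (X.d n i true - X.d n i false)

lemma d_sub_d (n : ℕ) (i j : Fin (n + 1)) (h : i ≤ j) :
    (X.d (n + 1) j.succ true - X.d (n + 1) j.succ false) ≫ (X.d n i true - X.d n i false) =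
    (X.d (n + 1) i.castSucc true - X.d (n + 1) i.castSucc false) ≫
      (X.d n j true - X.d n j false) := by
  simp only [Preadditive.sub_comp, Preadditive.comp_sub, X.d_d n i j _ _ h]
  abel

lemma objD_objD (n : ℕ) : X.objD (n + 1) ≫ X.objD n = 0 := by
  unfold objD
  simp only [Preadditive.comp_sum, Preadditive.sum_comp, ← Finset.sum_product']
  let P := Fin (n + 1) × Fin (n + 2)
  let S : Finset P := {ij : P | (ij.2 : ℕ) ≤ (ij.1 : ℕ)}
  rw [Finset.univ_product_univ, ← Finset.sum_add_sum_compl S, ← eq_neg_iff_add_eq_zero,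
    ← Finset.sum_neg_distrib]
  let φ : ∀ ij : P, ij ∈ S → P := fun ij hij =>
    (Fin.castLT ij.2 (lt_of_le_of_lt (Finset.mem_filter.mp hij).right (Fin.is_lt ij.1)), ij.1.succ)
  apply Finset.sum_bij φ
  · intro ij hij
    simp_rw [S, φ, Finset.compl_filter, Finset.mem_filter_univ, Fin.val_succ,
      Fin.val_castLT] at hij ⊢
    lia
  · rintro ⟨i, j⟩ hij ⟨i', j'⟩ hij' h
    rw [Prod.mk_inj]
    exact ⟨by simpa [φ] using! congr_arg Prod.snd h,
      by simpa [φ, Fin.castSucc_castLT] using! congr_arg Fin.castSucc (congr_arg Prod.fst h)⟩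
  · rintro ⟨i', j'⟩ hij'
    simp_rw [S, Finset.compl_filter, Finset.mem_filter_univ, not_le] at hij'
    refine ⟨(j'.pred <| ?_, Fin.castSucc i'), ?_, ?_⟩
    · rintro rfl
      simp only [Fin.val_zero, not_lt_zero] at hij'
    · simpa [S] using! Nat.le_sub_one_of_lt hij'
    · simp only [φ, Fin.castLT_castSucc, Fin.succ_pred]
  · rintro ⟨i, j⟩ hij
    have hj : (j : ℕ) ≤ i := by simpa [S] using! hij
    have hji : j.castLT (lt_of_le_of_lt hj i.is_lt) ≤ i := by
      rw [Fin.le_def]; simpa using hj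
    have key := X.d_sub_d n _ i hji
    rw [Fin.castSucc_castLT] at key
    dsimp only [φ]
    rw [Preadditive.zsmul_comp, Preadditive.comp_zsmul, Preadditive.zsmul_comp,
      Preadditive.comp_zsmul, smul_smul, smul_smul, ← neg_smul, key]
    congr 1
    simp only [Fin.val_succ, Fin.val_castLT]
    ring

/-- The product `(1 - s_1 ∂_1^1) (1 - s_2 ∂_2^1) ⋯ (1 - s_k ∂_k^1)` of endomorphisms of
`X_{n+1}`; multiplication in `End` is composition of maps, the rightmost factor being
applied first. -/
def sigmaAux (n k : ℕ) (hk : k ≤ n + 1) : End (X.X (n + 1)) :=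
  (List.ofFn fun i : Fin k =>
    𝟙 (X.X (n + 1)) - X.d n (Fin.castLE hk i) true ≫ X.s n (Fin.castLE hk i) :
      List (End (X.X (n + 1)))).prod

/-- The endomorphism `σ_n = (1 - s_1 ∂_1^1) ⋯ (1 - s_n ∂_n^1)` of `X_n`, with `σ_0 = 1`. -/
def sigma : ∀ n : ℕ, X.X n ⟶ X.X n
  | 0 => 𝟙 _
  | n + 1 => X.sigmaAux n (n + 1) le_rfl

lemma sigmaAux_zero (n : ℕ) : X.sigmaAux n 0 (Nat.zero_le _) = 𝟙 _ := by
  simp [sigmaAux, End.one_def]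

lemma sigmaAux_succ (n k : ℕ) (hk : k + 1 ≤ n + 1) :
    X.sigmaAux n (k + 1) hk =
      (𝟙 _ - X.d n ⟨k, hk⟩ true ≫ X.s n ⟨k, hk⟩) ≫ X.sigmaAux n k (by omega) := by
  unfold sigmaAux
  rw [List.ofFn_succ', List.concat_eq_append, List.prod_append, List.prod_singleton, End.mul_def]
  rfl

lemma sigmaAux_comp_d_ge (n k : ℕ) (hk : k ≤ n + 1) (j : Fin (n + 2)) (hj : k ≤ j) (a : Bool) :
    X.sigmaAux (n + 1) k (by omega) ≫ X.d (n + 1) j a =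
      X.d (n + 1) j a ≫ X.sigmaAux n k hk := by
  induction k with
  | zero => simp [sigmaAux_zero]
  | succ k ih =>
    have hjk : (⟨k, by omega⟩ : Fin (n + 1)) ≤ j.pred (by rintro rfl; simp at hj) := by
      rw [Fin.le_def]; simp; omega
    have e1 := X.d_d n _ _ true a hjk
    have e2 := X.s_d_gt n _ _ a hjk
    simp only [Fin.succ_pred, Fin.castSucc_mk] at e1 e2
    rw [sigmaAux_succ, sigmaAux_succ, Category.assoc, ih (by omega) (by omega),
      ← Category.assoc, ← Category.assoc]
    congr 1
    simp only [Preadditive.sub_comp, Preadditive.comp_sub, Category.id_comp, Category.comp_id,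
      Category.assoc]
    congr 1
    rw [e2, ← Category.assoc, ← e1, Category.assoc]

lemma sigmaAux_comp_d_lt (n k : ℕ) (hk : k + 1 ≤ n + 2) (j : Fin (n + 2)) (hj : (j : ℕ) ≤ k)
    (a : Bool) :
    X.sigmaAux (n + 1) (k + 1) hk ≫ X.d (n + 1) j a =
      (X.d (n + 1) j a - X.d (n + 1) j true) ≫ X.sigmaAux n k (by omega) := by
  induction k with
  | zero =>
    obtain rfl : j = 0 := by ext; simpa using hj
    rw [sigmaAux_succ, sigmaAux_zero, sigmaAux_zero]
    simp only [Category.comp_id]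
    change (𝟙 _ - X.d (n + 1) 0 true ≫ X.s (n + 1) 0) ≫ _ = _
    rw [Preadditive.sub_comp, Category.id_comp, Category.assoc, X.s_d_self, Category.comp_id]
  | succ k ih =>
    rcases Nat.lt_or_eq_of_le hj with hlt | heq
    · have hjk : j.castPred (by rintro rfl; simp at hlt; omega) ≤ (⟨k, by omega⟩ : Fin (n + 1)) := by
        rw [Fin.le_def]; simp; omega
      have e1 := fun b => X.d_d n _ _ b true hjk
      have e2 := X.s_d_lt n _ _ a hjk
      simp only [Fin.castSucc_castPred, Fin.succ_mk] at e1 e2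
      rw [sigmaAux_succ, Category.assoc, ih (by omega) (by omega), sigmaAux_succ X n k,
        ← Category.assoc, ← Category.assoc]
      congr 1
      have e2t := X.s_d_lt n _ _ true hjk
      simp only [Fin.castSucc_castPred, Fin.succ_mk] at e2t
      simp only [Preadditive.sub_comp, Preadditive.comp_sub, Category.id_comp, Category.comp_id,
        Category.assoc]
      rw [e2, e2t, ← Category.assoc, ← Category.assoc, e1, e1]
      simp only [Category.assoc]
      abel
    · have hj' : j = ⟨k + 1, by omega⟩ := by ext; exact heq
      rw [sigmaAux_succ, Category.assoc,
        sigmaAux_comp_d_ge X n (k + 1) (by omega) j (by omega), ← Category.assoc]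
      congr 1
      rw [← hj', Preadditive.sub_comp, Category.id_comp, Category.assoc, X.s_d_self, Category.comp_id]

/-- The image of `σ` is annihilated by the faces `∂_i^1`. -/
lemma sigma_comp_d_true (n : ℕ) (i : Fin (n + 1)) : X.sigma (n + 1) ≫ X.d n i true = 0 := by
  cases n with
  | zero =>
    obtain rfl : i = 0 := by ext; omega
    change X.sigmaAux 0 1 le_rfl ≫ _ = 0
    rw [sigmaAux_succ, sigmaAux_zero]
    simp only [Category.comp_id]
    change (𝟙 _ - X.d 0 0 true ≫ X.s 0 0) ≫ _ = _
    rw [Preadditive.sub_comp, Category.id_comp, Category.assoc, X.s_d_self, Category.comp_id,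
      sub_self]
  | succ n =>
    change X.sigmaAux (n + 1) (n + 2) _ ≫ _ = 0
    rw [sigmaAux_comp_d_lt X n (n + 1) le_rfl i (by omega), sub_self, zero_comp]

lemma sigma_comp_d_false (n : ℕ) (i : Fin (n + 1)) :
    X.sigma (n + 1) ≫ X.d n i false = (X.d n i false - X.d n i true) ≫ X.sigma n := by
  cases n with
  | zero =>
    obtain rfl : i = 0 := by ext; omega
    change X.sigmaAux 0 1 le_rfl ≫ _ = _ ≫ 𝟙 _
    rw [sigmaAux_succ, sigmaAux_zero]
    simp only [Category.comp_id]
    change (𝟙 _ - X.d 0 0 true ≫ X.s 0 0) ≫ _ = _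
    rw [Preadditive.sub_comp, Category.id_comp, Category.assoc, X.s_d_self, Category.comp_id]
  | succ n => exact sigmaAux_comp_d_lt X n (n + 1) le_rfl i (by omega) false

/-- `σ` is the identity on morphisms annihilated by the faces `∂_i^1`. -/
lemma comp_sigma {T : D} (n : ℕ) (x : T ⟶ X.X (n + 1))
    (hx : ∀ i, x ≫ X.d n i true = 0) : x ≫ X.sigma (n + 1) = x := by
  have aux : ∀ (k : ℕ) (hk : k ≤ n + 1), x ≫ X.sigmaAux n k hk = x := by
    intro k hk
    induction k with
    | zero => rw [sigmaAux_zero, Category.comp_id]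
    | succ k ih =>
      rw [sigmaAux_succ, ← Category.assoc, Preadditive.comp_sub, Category.comp_id,
        ← Category.assoc, hx, zero_comp, sub_zero, ih]
  exact aux (n + 1) le_rfl

lemma sigma_idem (n : ℕ) : X.sigma n ≫ X.sigma n = X.sigma n := by
  cases n with
  | zero => exact Category.comp_id _
  | succ n => exact X.comp_sigma n _ (X.sigma_comp_d_true n)

lemma sigma_comm (n : ℕ) : X.sigma (n + 1) ≫ X.objD n = X.objD n ≫ X.sigma n := by
  unfold objD
  rw [Preadditive.comp_sum, Preadditive.sum_comp]
  refine Finset.sum_congr rfl fun i _ => ?_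
  rw [Preadditive.comp_zsmul, Preadditive.zsmul_comp, Preadditive.comp_sub, sigma_comp_d_true,
    sigma_comp_d_false, zero_sub, ← Preadditive.neg_comp, neg_sub]

lemma PreHom.comp_objD {X Y : PseudocubicalObject D} (φ : PreHom X Y) (n : ℕ) :
    φ.f (n + 1) ≫ Y.objD n = X.objD n ≫ φ.f n := by
  unfold objD
  rw [Preadditive.comp_sum, Preadditive.sum_comp]
  refine Finset.sum_congr rfl fun i _ => ?_
  rw [Preadditive.comp_zsmul, Preadditive.zsmul_comp, Preadditive.comp_sub, Preadditive.sub_comp,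
    φ.comm, φ.comm]

/-- On morphisms annihilated by the faces `∂_i^1`, the differential only involves the `∂_i^0`. -/
lemma comp_objD_of_d_true {T : D} (n : ℕ) (x : T ⟶ X.X (n + 1))
    (hx : ∀ i, x ≫ X.d n i true = 0) :
    x ≫ X.objD n = ∑ i : Fin (n + 1), (-1 : ℤ) ^ (i : ℕ) • (x ≫ X.d n i false) := by
  unfold objD
  rw [Preadditive.comp_sum]
  refine Finset.sum_congr rfl fun i _ => ?_
  rw [Preadditive.comp_zsmul, Preadditive.comp_sub, hx, zero_sub, pow_succ, mul_neg_one, neg_smul,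
    smul_neg, neg_neg]

lemma objD_comp_one_sub_sigma (n : ℕ) :
    (𝟙 _ - X.sigma (n + 1)) ≫ X.objD n = X.objD n ≫ (𝟙 _ - X.sigma n) := by
  rw [Preadditive.sub_comp, Preadditive.comp_sub, sigma_comm, Category.id_comp, Category.comp_id]

variable [IsIdempotentComplete D]

instance hasKernel_one_sub_sigma (n : ℕ) : HasKernel (𝟙 (X.X n) - X.sigma n) :=
  (Idempotents.isIdempotentComplete_iff_idempotents_have_kernels D).1 inferInstance _ _
    (Idempotents.idem_of_id_sub_idem _ (X.sigma_idem n))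

/-- The normalized chain complex `N(X) = Ker(1 - σ)`, a subcomplex of `C(X)`. -/
def normalized : ChainComplex D ℕ :=
  ChainComplex.of (fun n => kernel (𝟙 (X.X n) - X.sigma n))
    (fun n => kernel.map _ _ (X.objD n) (X.objD n) (X.objD_comp_one_sub_sigma n))
    (fun n => by
      rw [← cancel_mono (kernel.ι _)]
      simp [X.objD_objD])

/-- The inclusion `N(X)_n ⟶ X_n`. -/
def normalizedι (n : ℕ) : X.normalized.X n ⟶ X.X n :=
  kernel.ι (𝟙 (X.X n) - X.sigma n)

instance (n : ℕ) : Mono (X.normalizedι n) :=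
  inferInstanceAs (Mono (kernel.ι (𝟙 (X.X n) - X.sigma n)))

lemma normalized_d_ι (n : ℕ) :
    X.normalized.d (n + 1) n ≫ X.normalizedι n = X.normalizedι (n + 1) ≫ X.objD n := by
  have h : X.normalized.d (n + 1) n =
      kernel.map _ _ (X.objD n) (X.objD n) (X.objD_comp_one_sub_sigma n) :=
    ChainComplex.of_d (fun n => kernel (𝟙 (X.X n) - X.sigma n))
      (fun n => kernel.map _ _ (X.objD n) (X.objD n) (X.objD_comp_one_sub_sigma n)) n
  rw [h]
  exact kernel.lift_ι _ _ _

lemma normalizedι_sigma (n : ℕ) : X.normalizedι n ≫ X.sigma n = X.normalizedι n := by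
  have h : X.normalizedι n ≫ (𝟙 (X.X n) - X.sigma n) = 0 := kernel.condition _
  rw [Preadditive.comp_sub, Category.comp_id, sub_eq_zero] at h
  exact h.symm

lemma normalizedι_d_true (n : ℕ) (i : Fin (n + 1)) :
    X.normalizedι (n + 1) ≫ X.d n i true = 0 := by
  rw [← normalizedι_sigma, Category.assoc, sigma_comp_d_true, comp_zero]

/-- Lifting of a morphism to `N(X)_n`. -/
def normalizedLift {T : D} (n : ℕ) (x : T ⟶ X.X n) (hx : x ≫ X.sigma n = x) :
    T ⟶ X.normalized.X n :=
  kernel.lift (𝟙 (X.X n) - X.sigma n) x (by rw [Preadditive.comp_sub, hx, Category.comp_id, sub_self])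

lemma normalizedLift_ι {T : D} (n : ℕ) (x : T ⟶ X.X n) (hx : x ≫ X.sigma n = x) :
    X.normalizedLift n x hx ≫ X.normalizedι n = x :=
  kernel.lift_ι _ _ _

variable {X} {Y Z : PseudocubicalObject D}

lemma PreHom.ι_comp_sigma (φ : PreHom X Y) (n : ℕ) :
    (X.normalizedι n ≫ φ.f n) ≫ Y.sigma n = X.normalizedι n ≫ φ.f n := by
  cases n with
  | zero => exact Category.comp_id _
  | succ n =>
    refine Y.comp_sigma n _ fun i => ?_
    rw [Category.assoc, φ.comm, ← Category.assoc, normalizedι_d_true, zero_comp]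

/-- The morphism `N(X) ⟶ N(Y)` induced by a precubical morphism. -/
def normalizedMap (φ : PreHom X Y) : X.normalized ⟶ Y.normalized :=
  ChainComplex.ofHom (fun n => Y.normalizedLift n (X.normalizedι n ≫ φ.f n) (φ.ι_comp_sigma n))
    (fun n => by
      rw [← cancel_mono (Y.normalizedι n), Category.assoc, normalized_d_ι, ← Category.assoc,
        normalizedLift_ι, Category.assoc, Category.assoc, normalizedLift_ι,
        φ.comp_objD, ← Category.assoc, ← normalized_d_ι]
      exact Category.assoc _ _ _)

lemma normalizedMap_f_ι (φ : PreHom X Y) (n : ℕ) :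
    (normalizedMap φ).f n ≫ Y.normalizedι n = X.normalizedι n ≫ φ.f n :=
  normalizedLift_ι _ _ _ (φ.ι_comp_sigma n)

lemma normalizedMap_id : normalizedMap (PreHom.id X) = 𝟙 X.normalized := by
  ext n
  rw [← cancel_mono (X.normalizedι n), normalizedMap_f_ι]
  simp [PreHom.id]

lemma normalizedMap_comp (φ : PreHom X Y) (ψ : PreHom Y Z) :
    normalizedMap (φ.comp ψ) = normalizedMap φ ≫ normalizedMap ψ := by
  ext n
  rw [← cancel_mono (Z.normalizedι n), normalizedMap_f_ι, HomologicalComplex.comp_f,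
    Category.assoc, normalizedMap_f_ι, ← Category.assoc, normalizedMap_f_ι, Category.assoc]
  rfl

lemma PreHomotopy.aux {φ ψ : PreHom X Y} (H : PreHomotopy φ ψ) (n : ℕ) (i : Fin (n + 1)) :
    (X.normalizedι n ≫ (H.h n - ψ.f n ≫ Y.s n 0)) ≫ Y.d n i true = 0 := by
  rw [Category.assoc, Preadditive.sub_comp, Category.assoc]
  refine Fin.cases ?_ (fun i => ?_) i
  · rw [H.h_zero_true, Y.s_d_self, Category.comp_id, sub_self, comp_zero]
  · cases n with
    | zero => exact i.elim0
    | succ n =>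
      have h := Y.s_d_gt n i 0 true (Fin.zero_le _)
      rw [Fin.castSucc_zero] at h
      rw [H.h_succ, h, ← Category.assoc (ψ.f _), ψ.comm, Category.assoc, ← Preadditive.comp_sub,
        ← Category.assoc, normalizedι_d_true, zero_comp]

lemma PreHomotopy.aux_false {φ ψ : PreHom X Y} (H : PreHomotopy φ ψ) (n : ℕ) (i : Fin (n + 1)) :
    (H.h (n + 1) - ψ.f (n + 1) ≫ Y.s (n + 1) 0) ≫ Y.d (n + 1) i.succ false =
      X.d n i false ≫ (H.h n - ψ.f n ≫ Y.s n 0) := by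
  have h := Y.s_d_gt n i 0 false (Fin.zero_le _)
  rw [Fin.castSucc_zero] at h
  rw [Preadditive.sub_comp, H.h_succ, Category.assoc, h, ← Category.assoc (ψ.f _), ψ.comm,
    Category.assoc, ← Preadditive.comp_sub]

lemma PreHomotopy.aux_zero {φ ψ : PreHom X Y} (H : PreHomotopy φ ψ) (n : ℕ) :
    (H.h n - ψ.f n ≫ Y.s n 0) ≫ Y.d n 0 false = φ.f n - ψ.f n := by
  rw [Preadditive.sub_comp, H.h_zero_false, Category.assoc, Y.s_d_self, Category.comp_id]

/-- The components of the chain homotopy on normalized complexes induced by a precubical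
homotopy. -/
def PreHomotopy.normalizedH {φ ψ : PreHom X Y} (H : PreHomotopy φ ψ) (n : ℕ) :
    X.normalized.X n ⟶ Y.normalized.X (n + 1) :=
  Y.normalizedLift (n + 1) (X.normalizedι n ≫ (H.h n - ψ.f n ≫ Y.s n 0))
    (Y.comp_sigma n _ (H.aux n))

lemma PreHomotopy.normalizedH_ι {φ ψ : PreHom X Y} (H : PreHomotopy φ ψ) (n : ℕ) :
    H.normalizedH n ≫ Y.normalizedι (n + 1) =
      X.normalizedι n ≫ (H.h n - ψ.f n ≫ Y.s n 0) :=
  normalizedLift_ι _ _ _ (Y.comp_sigma n _ (H.aux n))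

lemma PreHomotopy.comm_zero {φ ψ : PreHom X Y} (H : PreHomotopy φ ψ) :
    H.normalizedH 0 ≫ Y.normalized.d 1 0 = (normalizedMap φ - normalizedMap ψ).f 0 := by
  rw [← cancel_mono (Y.normalizedι 0), Category.assoc, normalized_d_ι, ← Category.assoc,
    normalizedH_ι, Y.comp_objD_of_d_true _ _ (H.aux 0), HomologicalComplex.sub_f_apply,
    Preadditive.sub_comp, normalizedMap_f_ι, normalizedMap_f_ι]
  have h := H.aux_zero 0
  rw [Fin.sum_univ_succ, Fin.sum_univ_zero, add_zero, Fin.val_zero, pow_zero, one_smul,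
    Category.assoc]
  rw [h, Preadditive.comp_sub]

lemma PreHomotopy.comm_succ {φ ψ : PreHom X Y} (H : PreHomotopy φ ψ) (n : ℕ) :
    X.normalized.d (n + 1) n ≫ H.normalizedH n +
      H.normalizedH (n + 1) ≫ Y.normalized.d (n + 2) (n + 1) =
        (normalizedMap φ - normalizedMap ψ).f (n + 1) := by
  rw [← cancel_mono (Y.normalizedι (n + 1)), Preadditive.add_comp, Category.assoc, Category.assoc,
    normalized_d_ι, ← Category.assoc (H.normalizedH (n + 1)), normalizedH_ι, normalizedH_ι,
    Y.comp_objD_of_d_true _ _ (H.aux (n + 1)), HomologicalComplex.sub_f_apply,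
    Preadditive.sub_comp, normalizedMap_f_ι, normalizedMap_f_ι, ← Category.assoc,
    normalized_d_ι, X.comp_objD_of_d_true _ _ (X.normalizedι_d_true n),
    Fin.sum_univ_succ (n := n + 1),
    Preadditive.sum_comp]
  simp only [Category.assoc, H.aux_false, H.aux_zero, Preadditive.zsmul_comp, Fin.val_succ, pow_succ,
    mul_neg_one, neg_smul, Finset.sum_neg_distrib, Fin.val_zero, pow_zero, one_smul]
  rw [Preadditive.comp_sub (X.normalizedι (n + 1)) (φ.f (n + 1)) (ψ.f (n + 1))]
  abel

/-- Precubically homotopic morphisms induce chain homotopic morphisms of normalized complexes. -/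
def PreHomotopy.normalizedHomotopy {φ ψ : PreHom X Y} (H : PreHomotopy φ ψ) :
    Homotopy (normalizedMap φ) (normalizedMap ψ) := by
  refine Homotopy.equivSubZero.symm ((Homotopy.ofEq ?_).trans
    (Homotopy.nullHomotopy' (fun i j hij =>
      H.normalizedH i ≫ eqToHom (congrArg Y.normalized.X hij))))
  ext n
  cases n with
  | zero =>
    rw [Homotopy.nullHomotopicMap'_f_of_not_rel_left (k₁ := 1) rfl (by simp)]
    simp [H.comm_zero]
  | succ n =>
    rw [Homotopy.nullHomotopicMap'_f (k₂ := n + 2) (k₀ := n) rfl rfl]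
    simp [H.comm_succ]

end Normalization

end PseudocubicalObject

/-! ## Pseudocubical resolutions -/

section Resolutions

variable {C : Type u} [Category.{v} C]

open PseudocubicalObject

/-- A pseudocubical object augmented over `Y`. -/
structure AugmentedPseudocubicalObject (Y : C) extends PseudocubicalObject C where
  aug : X 0 ⟶ Y
  aug_w : d 0 0 false ≫ aug = d 0 0 true ≫ aug

section CubicalKernel

variable [HasFiniteLimits C]

/-- The cubical kernel of a family of morphisms `f_i^a : X ⟶ Y`, `1 ≤ i ≤ n + 1`, `a ∈ {0, 1}`:
the universal object `K` with morphisms `k_i^a : K ⟶ X`, `1 ≤ i ≤ n + 2`, such that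
`f_i^a k_j^e = f_{j-1}^e k_i^a` for `i < j`. -/
abbrev cubicalKernel {X Y : C} {n : ℕ} (f : Fin (n + 1) → Bool → (X ⟶ Y)) : C :=
  equalizer
    (Pi.lift fun p : { p : Fin (n + 1) × Fin (n + 1) // p.1 ≤ p.2 } × Bool × Bool =>
      Pi.π (fun _ : Fin (n + 2) × Bool => X) (p.1.1.2.succ, p.2.2) ≫ f p.1.1.1 p.2.1)
    (Pi.lift fun p : { p : Fin (n + 1) × Fin (n + 1) // p.1 ≤ p.2 } × Bool × Bool =>
      Pi.π (fun _ : Fin (n + 2) × Bool => X) (p.1.1.1.castSucc, p.2.1) ≫ f p.1.1.2 p.2.2)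

/-- The universal morphisms of the cubical kernel. -/
def cubicalKernelπ {X Y : C} {n : ℕ} (f : Fin (n + 1) → Bool → (X ⟶ Y)) (i : Fin (n + 2))
    (a : Bool) : cubicalKernel f ⟶ X :=
  equalizer.ι _ _ ≫ Pi.π (fun _ : Fin (n + 2) × Bool => X) (i, a)

/-- The universal property of the cubical kernel. -/
def cubicalKernelLift {X Y T : C} {n : ℕ} (f : Fin (n + 1) → Bool → (X ⟶ Y))
    (x : Fin (n + 2) → Bool → (T ⟶ X))
    (hx : ∀ (i j : Fin (n + 1)) (a e : Bool), i ≤ j →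
      x j.succ e ≫ f i a = x i.castSucc a ≫ f j e) :
    T ⟶ cubicalKernel f :=
  equalizer.lift (Pi.lift fun p => x p.1 p.2) (by
    ext ⟨⟨⟨i, j⟩, hij⟩, a, e⟩
    simpa using hx i j a e hij)

lemma cubicalKernelLift_π {X Y T : C} {n : ℕ} (f : Fin (n + 1) → Bool → (X ⟶ Y))
    (x : Fin (n + 2) → Bool → (T ⟶ X))
    (hx : ∀ (i j : Fin (n + 1)) (a e : Bool), i ≤ j →
      x j.succ e ≫ f i a = x i.castSucc a ≫ f j e) (i : Fin (n + 2)) (a : Bool) :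
    cubicalKernelLift f x hx ≫ cubicalKernelπ f i a = x i a := by
  unfold cubicalKernelLift cubicalKernelπ
  rw [← Category.assoc, equalizer.lift_ι, Pi.lift_π]

lemma cubicalKernel_hom_ext {X Y T : C} {n : ℕ} (f : Fin (n + 1) → Bool → (X ⟶ Y))
    {u v : T ⟶ cubicalKernel f}
    (h : ∀ i a, u ≫ cubicalKernelπ f i a = v ≫ cubicalKernelπ f i a) : u = v := by
  apply equalizer.hom_ext
  ext ⟨i, a⟩
  rw [Category.assoc, Category.assoc]
  exact h i a

/-- An augmented pseudocubical object `X ⟶ Y` is `P`-exact if `X_0 ⟶ Y`, the morphism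
`(∂_1^0, ∂_1^1) : X_1 ⟶ X_0 ×_Y X_0`, and all the canonical morphisms from `X_{n+2}` to the cubical
kernel of the faces `X_{n+1} ⟶ X_n` are `P`-epimorphisms. -/
structure AugmentedPseudocubicalObject.IsExact (P : ObjectProperty C) {Y : C}
    (X : AugmentedPseudocubicalObject Y) : Prop where
  zero : IsPEpi P X.aug
  one : IsPEpi P (pullback.lift (f := X.aug) (g := X.aug) (X.d 0 0 false) (X.d 0 0 true) X.aug_w)
  succ : ∀ n : ℕ, IsPEpi P (cubicalKernelLift (X.d n) (X.d (n + 1)) (X.d_d n))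

/-- A `P`-projective pseudocubical resolution of `Y`. -/
structure PseudocubicalResolution (P : ObjectProperty C) (Y : C) extends
    AugmentedPseudocubicalObject Y where
  mem : ∀ n, P (X n)
  exact : toAugmentedPseudocubicalObject.IsExact P

namespace AugmentedPseudocubicalObject

variable {P : ObjectProperty C} {A B : C} {X : AugmentedPseudocubicalObject A}
  {Y : AugmentedPseudocubicalObject B}

lemma IsExact.lift_one (hY : Y.IsExact P) {Q : C} (hQ : P Q) (x : Bool → (Q ⟶ Y.X 0))
    (hx : x false ≫ Y.aug = x true ≫ Y.aug) :
    ∃ z : Q ⟶ Y.X 1, ∀ a, z ≫ Y.d 0 0 a = x a := by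
  obtain ⟨z, hz⟩ := hY.one Q hQ (pullback.lift (x false) (x true) hx)
  refine ⟨z, fun a => ?_⟩
  cases a with
  | false =>
    have h := congrArg (· ≫ pullback.fst _ _) hz
    simpa only [Category.assoc, pullback.lift_fst] using h
  | true =>
    have h := congrArg (· ≫ pullback.snd _ _) hz
    simpa only [Category.assoc, pullback.lift_snd] using h

lemma IsExact.lift_succ (hY : Y.IsExact P) {Q : C} (hQ : P Q) (n : ℕ)
    (x : Fin (n + 2) → Bool → (Q ⟶ Y.X (n + 1)))
    (hx : ∀ (i j : Fin (n + 1)) (a e : Bool), i ≤ j →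
      x j.succ e ≫ Y.d n i a = x i.castSucc a ≫ Y.d n j e) :
    ∃ z : Q ⟶ Y.X (n + 2), ∀ i a, z ≫ Y.d (n + 1) i a = x i a := by
  obtain ⟨z, hz⟩ := hY.succ n Q hQ (cubicalKernelLift (Y.d n) x hx)
  refine ⟨z, fun i a => ?_⟩
  have h := congrArg (· ≫ cubicalKernelπ (Y.d n) i a) hz
  simpa only [Category.assoc, cubicalKernelLift_π] using h

/-- Two consecutive components of a precubical morphism. -/
def PrePair (X : AugmentedPseudocubicalObject A) (Y : AugmentedPseudocubicalObject B) (n : ℕ) :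
    Type v :=
  { p : (X.X n ⟶ Y.X n) × (X.X (n + 1) ⟶ Y.X (n + 1)) //
    ∀ i a, p.2 ≫ Y.d n i a = X.d n i a ≫ p.1 }

lemma PrePair.exists_succ (hX : ∀ n, P (X.X n)) (hY : Y.IsExact P) {n : ℕ} (p : PrePair X Y n) :
    ∃ q : PrePair X Y (n + 1), q.1.1 = p.1.2 := by
  obtain ⟨z, hz⟩ := hY.lift_succ (hX (n + 2)) n (fun i a => X.d (n + 1) i a ≫ p.1.2) (by
    intro i j a e hij
    rw [Category.assoc, p.2, Category.assoc, p.2, ← Category.assoc, X.d_d n i j a e hij,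
      Category.assoc])
  exact ⟨⟨(p.1.2, z), hz⟩, rfl⟩

/-- Existence part of the comparison theorem for precubical resolutions. -/
lemma exists_preHom (hX : ∀ n, P (X.X n)) (hY : Y.IsExact P) (f : A ⟶ B) :
    ∃ φ : PreHom X.toPseudocubicalObject Y.toPseudocubicalObject,
      φ.f 0 ≫ Y.aug = X.aug ≫ f := by
  obtain ⟨z, hz⟩ := hY.zero _ (hX 0) (X.aug ≫ f)
  obtain ⟨w, hw⟩ := hY.lift_one (hX 1) (fun a => X.d 0 0 a ≫ z) (by
    have hz' : z ≫ Y.aug = X.aug ≫ f := hz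
    rw [Category.assoc, Category.assoc, hz', ← Category.assoc, ← Category.assoc, X.aug_w])
  choose next hnext using fun (n : ℕ) (p : PrePair X Y n) => p.exists_succ hX hY
  let p₀ : PrePair X Y 0 := ⟨(z, w), fun i a => by
    obtain rfl : i = 0 := by ext; omega
    exact hw a⟩
  let seq : ∀ n, PrePair X Y n := fun n => Nat.rec p₀ next n
  refine ⟨⟨fun n => (seq n).1.1, fun n i a => ?_⟩, hz⟩
  have h : (seq (n + 1)).1.1 = (seq n).1.2 := hnext n (seq n)
  rw [h]
  exact (seq n).2 i a

/-- Two consecutive components of a precubical homotopy. -/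
def HomotopyPair (φ ψ : PreHom X.toPseudocubicalObject Y.toPseudocubicalObject) (n : ℕ) :
    Type v :=
  { p : (X.X n ⟶ Y.X (n + 1)) × (X.X (n + 1) ⟶ Y.X (n + 2)) //
    (p.1 ≫ Y.d n 0 false = φ.f n ∧ p.1 ≫ Y.d n 0 true = ψ.f n) ∧
    (p.2 ≫ Y.d (n + 1) 0 false = φ.f (n + 1) ∧ p.2 ≫ Y.d (n + 1) 0 true = ψ.f (n + 1)) ∧
    ∀ i a, p.2 ≫ Y.d (n + 1) i.succ a = X.d n i a ≫ p.1 }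

/-- The faces prescribed for the next component of a precubical homotopy. -/
def homotopyFaces (φ ψ : PreHom X.toPseudocubicalObject Y.toPseudocubicalObject) (n : ℕ)
    (h : X.X n ⟶ Y.X (n + 1)) (i : Fin (n + 2)) (a : Bool) : X.X (n + 1) ⟶ Y.X (n + 1) :=
  Fin.cases (bif a then ψ.f (n + 1) else φ.f (n + 1)) (fun i => X.d n i a ≫ h) i

lemma exists_homotopyPair_zero (hX : ∀ n, P (X.X n)) (hY : Y.IsExact P)
    (φ ψ : PreHom X.toPseudocubicalObject Y.toPseudocubicalObject)
    (h : φ.f 0 ≫ Y.aug = ψ.f 0 ≫ Y.aug) : Nonempty (HomotopyPair φ ψ 0) := by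
  obtain ⟨z, hz⟩ := hY.lift_one (hX 0) (fun a => bif a then ψ.f 0 else φ.f 0) h
  obtain ⟨w, hw⟩ := hY.lift_succ (hX 1) 0 (homotopyFaces φ ψ 0 z) (by
    intro i j a e _
    obtain rfl : i = 0 := by ext; omega
    obtain rfl : j = 0 := by ext; omega
    change (X.d 0 0 e ≫ z) ≫ _ = (bif a then ψ.f 1 else φ.f 1) ≫ _
    rw [Category.assoc, hz]
    cases a
    · exact (φ.comm 0 0 e).symm
    · exact (ψ.comm 0 0 e).symm)
  exact ⟨⟨(z, w), ⟨hz false, hz true⟩, ⟨hw 0 false, hw 0 true⟩, fun i a => hw i.succ a⟩⟩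

lemma HomotopyPair.exists_succ (hX : ∀ n, P (X.X n)) (hY : Y.IsExact P)
    {φ ψ : PreHom X.toPseudocubicalObject Y.toPseudocubicalObject} {n : ℕ}
    (p : HomotopyPair φ ψ n) : ∃ q : HomotopyPair φ ψ (n + 1), q.1.1 = p.1.2 := by
  obtain ⟨w, hw⟩ := hY.lift_succ (hX (n + 2)) (n + 1) (homotopyFaces φ ψ (n + 1) p.1.2) (by
    intro i j a e hij
    change (X.d (n + 1) j e ≫ p.1.2) ≫ _ = _
    rw [Category.assoc]
    revert hij
    refine Fin.cases ?_ (fun i => ?_) i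
    · intro _
      change _ = (bif a then ψ.f (n + 2) else φ.f (n + 2)) ≫ _
      cases a
      · exact (congrArg (X.d (n + 1) j e ≫ ·) p.2.2.1.1).trans (φ.comm (n + 1) j e).symm
      · exact (congrArg (X.d (n + 1) j e ≫ ·) p.2.2.1.2).trans (ψ.comm (n + 1) j e).symm
    · refine Fin.cases (fun h => ?_) (fun j hij => ?_) j
      · exact absurd h (by simp)
      · change _ = (X.d (n + 1) i.castSucc a ≫ p.1.2) ≫ _
        rw [p.2.2.2, Category.assoc, p.2.2.2, ← Category.assoc, ← Category.assoc,
          X.d_d n i j a e (Fin.succ_le_succ_iff.1 hij)])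
  exact ⟨⟨(p.1.2, w), p.2.2.1, ⟨hw 0 false, hw 0 true⟩, fun i a => hw i.succ a⟩, rfl⟩

/-- Uniqueness part of the comparison theorem for precubical resolutions. -/
lemma nonempty_preHomotopy (hX : ∀ n, P (X.X n)) (hY : Y.IsExact P)
    (φ ψ : PreHom X.toPseudocubicalObject Y.toPseudocubicalObject)
    (h : φ.f 0 ≫ Y.aug = ψ.f 0 ≫ Y.aug) : Nonempty (PreHomotopy φ ψ) := by
  obtain ⟨p₀⟩ := exists_homotopyPair_zero hX hY φ ψ h
  choose next hnext using fun (n : ℕ) (p : HomotopyPair φ ψ n) => p.exists_succ hX hY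
  let seq : ∀ n, HomotopyPair φ ψ n := fun n => Nat.rec p₀ next n
  refine ⟨⟨fun n => (seq n).1.1, fun n => (seq n).2.1.1, fun n => (seq n).2.1.2,
    fun n i a => ?_⟩⟩
  have h : (seq (n + 1)).1.1 = (seq n).1.2 := hnext n (seq n)
  rw [h]
  exact (seq n).2.2.2 i a

end AugmentedPseudocubicalObject

end CubicalKernel

end Resolutions

/-! ## Cubical derived functors -/

section CubicalDerivedFunctors

open PseudocubicalObject AugmentedPseudocubicalObject

variable {C : Type u} [Category.{v} C] [HasFiniteLimits C] {P : ObjectProperty C}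

namespace PseudocubicalResolution

/-- A precubical morphism of resolutions extending `f`. -/
def lift {A B : C} (X : PseudocubicalResolution P A) (Y : PseudocubicalResolution P B)
    (f : A ⟶ B) : PreHom X.toPseudocubicalObject Y.toPseudocubicalObject :=
  (exists_preHom X.mem Y.exact f).choose

lemma lift_aug {A B : C} (X : PseudocubicalResolution P A) (Y : PseudocubicalResolution P B)
    (f : A ⟶ B) : (X.lift Y f).f 0 ≫ Y.aug = X.aug ≫ f :=
  (exists_preHom X.mem Y.exact f).choose_spec

end PseudocubicalResolution

variable {D : Type u'} [Category.{v'} D] [Abelian D]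

/-- `H_n(N(F(φ)))` for a precubical morphism `φ`. -/
def homologyNormalizedMap (F : C ⥤ D) {X Y : PseudocubicalObject C} (φ : PreHom X Y) (n : ℕ) :
    (X.map F).normalized.homology n ⟶ (Y.map F).normalized.homology n :=
  HomologicalComplex.homologyMap (normalizedMap (φ.map F)) n

lemma homologyNormalizedMap_eq (F : C ⥤ D) {A B : C} (X : PseudocubicalResolution P A)
    (Y : PseudocubicalResolution P B)
    (φ ψ : PreHom X.toPseudocubicalObject Y.toPseudocubicalObject)
    (h : φ.f 0 ≫ Y.aug = ψ.f 0 ≫ Y.aug) (n : ℕ) :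
    homologyNormalizedMap F φ n = homologyNormalizedMap F ψ n := by
  obtain ⟨H⟩ := nonempty_preHomotopy X.mem Y.exact φ ψ h
  exact (H.map F).normalizedHomotopy.homologyMap_eq n

/-- The cubical derived functor `L^□_n F : C ⥤ D`, computed by means of chosen `P`-projective
pseudocubical resolutions `R A` of the objects `A` of `C`:
on objects it is `H_n(N(F(R A)))`, and on morphisms it is induced by any precubical
morphism of resolutions extending the given morphism. -/
def cubicalDerivedObj (R : ∀ A : C, PseudocubicalResolution P A) (n : ℕ) (F : C ⥤ D) : C ⥤ D where
  obj A := ((R A).toPseudocubicalObject.map F).normalized.homology n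
  map {A B} f := homologyNormalizedMap F ((R A).lift (R B) f) n
  map_id A := by
    rw [homologyNormalizedMap_eq F (R A) (R A) _ (PreHom.id _)
      (by rw [PseudocubicalResolution.lift_aug]; simp [PreHom.id])]
    have h : (PreHom.id (R A).toPseudocubicalObject).map F = PreHom.id _ := by
      ext k; exact F.map_id _
    unfold homologyNormalizedMap
    rw [h, normalizedMap_id, HomologicalComplex.homologyMap_id]
  map_comp {A₁ A₂ A₃} f g := by
    rw [homologyNormalizedMap_eq F (R A₁) (R A₃) _
      (((R A₁).lift (R A₂) f).comp ((R A₂).lift (R A₃) g)) (by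
        rw [PseudocubicalResolution.lift_aug]
        change _ = (_ ≫ _) ≫ _
        have h₁ := (R A₁).lift_aug (R A₂) f
        have h₂ := (R A₂).lift_aug (R A₃) g
        rw [Category.assoc, h₂, ← Category.assoc (((R A₁).lift (R A₂) f).f 0), h₁,
          Category.assoc])]
    have h : (((R A₁).lift (R A₂) f).comp ((R A₂).lift (R A₃) g)).map F =
        (((R A₁).lift (R A₂) f).map F).comp (((R A₂).lift (R A₃) g).map F) := by
      ext k; exact F.map_comp _ _
    unfold homologyNormalizedMap
    rw [h, normalizedMap_comp, HomologicalComplex.homologyMap_comp]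

/-- The cubical derived functors `L^□_n F` of `F : C ⥤ D`, as a functor in `F`. -/
def cubicalDerived (R : ∀ A : C, PseudocubicalResolution P A) (n : ℕ) :
    (C ⥤ D) ⥤ (C ⥤ D) where
  obj F := cubicalDerivedObj R n F
  map {F G} α :=
    { app A := HomologicalComplex.homologyMap
        (normalizedMap (PreHom.ofNatTrans α (R A).toPseudocubicalObject)) n
      naturality A B f := by
        change HomologicalComplex.homologyMap _ _ ≫ _ = _ ≫ HomologicalComplex.homologyMap _ _
        rw [← HomologicalComplex.homologyMap_comp, ← HomologicalComplex.homologyMap_comp,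
          ← normalizedMap_comp, ← normalizedMap_comp]
        congr 2
        ext k
        exact α.naturality _ }
  map_id F := by
    ext A
    change HomologicalComplex.homologyMap (normalizedMap (PreHom.id _)) n = 𝟙 _
    rw [normalizedMap_id, HomologicalComplex.homologyMap_id]
  map_comp α β := by
    ext A
    change HomologicalComplex.homologyMap (normalizedMap
      ((PreHom.ofNatTrans α _).comp (PreHom.ofNatTrans β _))) n = _ ≫ _
    rw [normalizedMap_comp, HomologicalComplex.homologyMap_comp]
    rfl

end CubicalDerivedFunctors

/-! ## Relative derived functors of additive functors -/

section RelativeDerivedFunctors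

variable {A : Type u} [Category.{v} A] [Preadditive A]

/-- The sequence `X ⟶ Y ⟶ Z` is `P`-exact. -/
def IsPExact (P : ObjectProperty A) {X Y Z : A} (f : X ⟶ Y) (g : Y ⟶ Z) : Prop :=
  f ≫ g = 0 ∧ ∀ Q, P Q → Function.Exact (fun x : Q ⟶ X => x ≫ f) (fun y : Q ⟶ Y => y ≫ g)

/-- The closure of a class of objects `P`: all the objects `Q` such that `Hom(Q, -)` is exact on
all `P`-exact sequences. -/
def exactClosure (P : ObjectProperty A) : ObjectProperty A := fun Q =>
  ∀ ⦃X Y Z : A⦄ (f : X ⟶ Y) (g : Y ⟶ Z), IsPExact P f g →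
    Function.Exact (fun x : Q ⟶ X => x ≫ f) (fun y : Q ⟶ Y => y ≫ g)

/-- The complex `⋯ ⟶ K_1 ⟶ K_0 ⟶ Y` over `Y` is `P`-acyclic: it is a complex, and for every `Q` in
`P`, the sequence `⋯ ⟶ Hom(Q, K_1) ⟶ Hom(Q, K_0) ⟶ Hom(Q, Y) ⟶ 0` is exact. -/
structure IsAcyclic (P : ObjectProperty A) (K : ChainComplex A ℕ) {Y : A} (ε : K.X 0 ⟶ Y) :
    Prop where
  d_aug : K.d 1 0 ≫ ε = 0
  surjective : ∀ Q, P Q → Function.Surjective (fun x : Q ⟶ K.X 0 => x ≫ ε)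
  exact_zero : ∀ Q, P Q →
    Function.Exact (fun x : Q ⟶ K.X 1 => x ≫ K.d 1 0) (fun x : Q ⟶ K.X 0 => x ≫ ε)
  exact_succ : ∀ (n : ℕ) (Q : A), P Q →
    Function.Exact (fun x : Q ⟶ K.X (n + 2) => x ≫ K.d (n + 2) (n + 1))
      (fun x : Q ⟶ K.X (n + 1) => x ≫ K.d (n + 1) n)

/-- The complex `⋯ ⟶ K_1 ⟶ K_0 ⟶ Y` over `Y` is a `P`-resolution of `Y`. -/
structure IsResolution (P : ObjectProperty A) (K : ChainComplex A ℕ) {Y : A} (ε : K.X 0 ⟶ Y) :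
    Prop extends IsAcyclic P K ε where
  mem : ∀ n, P (K.X n)

/-- A `P`-resolution of `Y`. -/
structure Resolution (P : ObjectProperty A) (Y : A) where
  complex : ChainComplex A ℕ
  aug : complex.X 0 ⟶ Y
  isResolution : IsResolution P complex aug

/-- The class of objects which possess a `P`-resolution. -/
def possessesResolution (P : ObjectProperty A) : ObjectProperty A :=
  fun Y => Nonempty (Resolution P Y)

variable {P : ObjectProperty A}

namespace Resolution

lemma exists_lift {Y Z : A} (R : Resolution P Y) (S : Resolution P Z) (f : Y ⟶ Z) :
    ∃ φ : R.complex ⟶ S.complex, φ.f 0 ≫ S.aug = R.aug ≫ f := by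
  obtain ⟨z, hz⟩ := S.isResolution.surjective _ (R.isResolution.mem 0) (R.aug ≫ f)
  have hz' : z ≫ S.aug = R.aug ≫ f := hz
  obtain ⟨w, hw⟩ := (S.isResolution.exact_zero _ (R.isResolution.mem 1)
    (R.complex.d 1 0 ≫ z)).1 (by
      change (_ ≫ z) ≫ _ = 0
      rw [Category.assoc, hz', ← Category.assoc, R.isResolution.d_aug, zero_comp])
  refine ⟨ChainComplex.mkHom _ _ z w hw fun n p => ?_, hz⟩
  have h := (S.isResolution.exact_succ n _ (R.isResolution.mem (n + 2))
    (R.complex.d (n + 2) (n + 1) ≫ p.2.1)).1 (by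
      change (_ ≫ p.2.1) ≫ _ = 0
      rw [Category.assoc, p.2.2, ← Category.assoc, HomologicalComplex.d_comp_d, zero_comp])
  exact ⟨h.choose, h.choose_spec⟩

lemma nonempty_homotopy_zero {Y Z : A} (R : Resolution P Y) (S : Resolution P Z)
    (φ : R.complex ⟶ S.complex) (h : φ.f 0 ≫ S.aug = 0) : Nonempty (Homotopy φ 0) := by
  obtain ⟨z, hz⟩ := (S.isResolution.exact_zero _ (R.isResolution.mem 0) (φ.f 0)).1 h
  have hz' : z ≫ S.complex.d 1 0 = φ.f 0 := hz
  obtain ⟨w, hw⟩ := (S.isResolution.exact_succ 0 _ (R.isResolution.mem 1)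
    (φ.f 1 - R.complex.d 1 0 ≫ z)).1 (by
      change (_ - _) ≫ _ = 0
      rw [Preadditive.sub_comp, Category.assoc, hz', φ.comm, sub_self])
  have hw' : w ≫ S.complex.d 2 1 = φ.f 1 - R.complex.d 1 0 ≫ z := hw
  refine ⟨Homotopy.mkInductive φ z hz'.symm w (by rw [hw']; abel) fun n p => ?_⟩
  have h := (S.isResolution.exact_succ (n + 1) _ (R.isResolution.mem (n + 2))
    (φ.f (n + 2) - R.complex.d (n + 2) (n + 1) ≫ p.2.1)).1 (by
      change (_ - _) ≫ _ = 0
      have hp : p.2.1 ≫ S.complex.d (n + 2) (n + 1) =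
          φ.f (n + 1) - R.complex.d (n + 1) n ≫ p.1 :=
        eq_sub_of_add_eq' p.2.2.symm
      rw [Preadditive.sub_comp, Category.assoc, hp, φ.comm, Preadditive.comp_sub,
        ← Category.assoc (R.complex.d (n + 2) (n + 1)), HomologicalComplex.d_comp_d, zero_comp,
        sub_zero, sub_self])
  refine ⟨h.choose, ?_⟩
  have h' : h.choose ≫ S.complex.d (n + 3) (n + 2) =
    φ.f (n + 2) - R.complex.d (n + 2) (n + 1) ≫ p.2.1 := h.choose_spec
  rw [h']
  abel

lemma nonempty_homotopy {Y Z : A} (R : Resolution P Y) (S : Resolution P Z)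
    (φ ψ : R.complex ⟶ S.complex) (h : φ.f 0 ≫ S.aug = ψ.f 0 ≫ S.aug) :
    Nonempty (Homotopy φ ψ) := by
  obtain ⟨H⟩ := nonempty_homotopy_zero R S (φ - ψ) (by
    rw [HomologicalComplex.sub_f_apply, Preadditive.sub_comp, h, sub_self])
  exact ⟨Homotopy.equivSubZero.symm H⟩

/-- A chain map of resolutions extending `f`. -/
def lift {Y Z : A} (R : Resolution P Y) (S : Resolution P Z) (f : Y ⟶ Z) :
    R.complex ⟶ S.complex :=
  (R.exists_lift S f).choose

lemma lift_aug {Y Z : A} (R : Resolution P Y) (S : Resolution P Z) (f : Y ⟶ Z) :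
    (R.lift S f).f 0 ≫ S.aug = R.aug ≫ f :=
  (R.exists_lift S f).choose_spec

end Resolution

variable {D : Type u'} [Category.{v'} D] [Abelian D]

/-- `H_n(F(φ))` for a chain map `φ`. -/
def homologyMapOf (F : A ⥤ D) [F.Additive] {K L : ChainComplex A ℕ} (φ : K ⟶ L) (n : ℕ) :
    ((F.mapHomologicalComplex _).obj K).homology n ⟶
      ((F.mapHomologicalComplex _).obj L).homology n :=
  HomologicalComplex.homologyMap ((F.mapHomologicalComplex _).map φ) n

lemma homologyMapOf_eq (F : A ⥤ D) [F.Additive] {Y Z : A} (R : Resolution P Y)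
    (S : Resolution P Z) (φ ψ : R.complex ⟶ S.complex)
    (h : φ.f 0 ≫ S.aug = ψ.f 0 ≫ S.aug) (n : ℕ) :
    homologyMapOf F φ n = homologyMapOf F ψ n := by
  obtain ⟨H⟩ := R.nonempty_homotopy S φ ψ h
  exact (F.mapHomotopy H).homologyMap_eq n

/-- The relative left derived functor `L^P_n F` of an additive functor `F : A ⥤ D`, defined on the
full subcategory of the objects of `A` which possess a `P`-resolution, computed by means
of chosen `P`-resolutions `R Y`: on objects it is `H_n(F(R Y))`, and on morphisms it is induced by
any chain map extending the given morphism. -/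
def relativeDerivedObj (R : ∀ Y : (possessesResolution P).FullSubcategory, Resolution P Y.obj)
    (n : ℕ) (F : A ⥤ D) [F.Additive] : (possessesResolution P).FullSubcategory ⥤ D where
  obj Y := ((F.mapHomologicalComplex _).obj (R Y).complex).homology n
  map {Y Z} f := homologyMapOf F ((R Y).lift (R Z) f.hom) n
  map_id Y := by
    rw [homologyMapOf_eq F (R Y) (R Y) _ (𝟙 _) (by rw [Resolution.lift_aug]; simp)]
    unfold homologyMapOf
    rw [CategoryTheory.Functor.map_id, HomologicalComplex.homologyMap_id]
  map_comp {Y₁ Y₂ Y₃} f g := by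
    rw [homologyMapOf_eq F (R Y₁) (R Y₃) _ ((R Y₁).lift (R Y₂) f.hom ≫ (R Y₂).lift (R Y₃) g.hom) (by
        have h₁ := (R Y₁).lift_aug (R Y₂) f.hom
        have h₂ := (R Y₂).lift_aug (R Y₃) g.hom
        rw [Resolution.lift_aug, HomologicalComplex.comp_f, Category.assoc, h₂,
          ← Category.assoc (((R Y₁).lift (R Y₂) f.hom).f 0), h₁, Category.assoc]
        rfl)]
    unfold homologyMapOf
    rw [CategoryTheory.Functor.map_comp, HomologicalComplex.homologyMap_comp]

/-- The relative left derived functors `L^P_n F`, as a functor in the additive functor `F`. -/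
def relativeDerived (R : ∀ Y : (possessesResolution P).FullSubcategory, Resolution P Y.obj)
    (n : ℕ) : (A ⥤+ D) ⥤ ((possessesResolution P).FullSubcategory ⥤ D) where
  obj F := relativeDerivedObj R n F.obj
  map {F G} α :=
    { app Y := HomologicalComplex.homologyMap
        ((NatTrans.mapHomologicalComplex α.hom _).app (R Y).complex) n
      naturality Y Z f := by
        change HomologicalComplex.homologyMap _ _ ≫ _ = _ ≫ HomologicalComplex.homologyMap _ _
        rw [← HomologicalComplex.homologyMap_comp, ← HomologicalComplex.homologyMap_comp,
          NatTrans.naturality] }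
  map_id F := by
    ext Y
    change HomologicalComplex.homologyMap
      ((NatTrans.mapHomologicalComplex (𝟙 F.obj) _).app (R Y).complex) n = 𝟙 _
    rw [NatTrans.mapHomologicalComplex_id, NatTrans.id_app, HomologicalComplex.homologyMap_id]
  map_comp {F G H} α β := by
    ext Y
    change HomologicalComplex.homologyMap
      ((NatTrans.mapHomologicalComplex (α.hom ≫ β.hom) _).app (R Y).complex) n = _ ≫ _
    rw [NatTrans.mapHomologicalComplex_comp, NatTrans.comp_app, HomologicalComplex.homologyMap_comp]
    rfl

end RelativeDerivedFunctors

/-! ## The additive extension of a functor -/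

section AdditiveExtension

variable {C : Type u} [Category.{v} C] {D : Type u'} [Category.{v'} D] [Preadditive D]

/-- The additive extension of `F` on morphisms: `∑ r_k f_k` is sent to `∑ r_k F(f_k)`. -/
def additiveExtensionHom (F : C ⥤ D) (X Y : C) : ((X ⟶ Y) →₀ ℤ) →+ (F.obj X ⟶ F.obj Y) :=
  Finsupp.liftAddHom fun f => zmultiplesHom _ (F.map f)

lemma additiveExtensionHom_single (F : C ⥤ D) (X Y : C) (f : X ⟶ Y) (r : ℤ) :
    additiveExtensionHom F X Y (Finsupp.single f r) = r • F.map f := by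
  simp [additiveExtensionHom]

lemma additiveExtensionHom_id (F : C ⥤ D) (X : C) :
    additiveExtensionHom F X X (Finsupp.single (𝟙 X) 1) = 𝟙 (F.obj X) := by
  rw [additiveExtensionHom_single, one_smul, F.map_id]

lemma additiveExtensionHom_apply (F : C ⥤ D) (X Y : C) (f : (X ⟶ Y) →₀ ℤ) :
    additiveExtensionHom F X Y f = ∑ u ∈ f.support, f u • F.map u := by
  simp [additiveExtensionHom, Finsupp.liftAddHom_apply, Finsupp.sum]

lemma additiveExtensionHom_comp (F : C ⥤ D) {X Y Z : C} (f : (X ⟶ Y) →₀ ℤ) (g : (Y ⟶ Z) →₀ ℤ) :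
    additiveExtensionHom F X Z
        (f.sum fun u r => g.sum fun v s => Finsupp.single (u ≫ v) (r * s)) =
      additiveExtensionHom F X Y f ≫ additiveExtensionHom F Y Z g := by
  rw [additiveExtensionHom_apply F X Y, additiveExtensionHom_apply F Y Z, Preadditive.sum_comp]
  simp only [Finsupp.sum, map_sum, additiveExtensionHom_single, Preadditive.comp_sum,
    Preadditive.zsmul_comp, Preadditive.comp_zsmul, smul_smul, F.map_comp, mul_comm]

/-- The additive extension `F_ad : ℤC ⥤ D` of a functor `F : C ⥤ D`, where `ℤC` is the free
preadditive category generated by `C`. -/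
def additiveExtensionObj (F : C ⥤ D) : Free ℤ C ⥤ D where
  obj X := F.obj X
  map {X Y} f := additiveExtensionHom F X Y f
  map_id X := additiveExtensionHom_id F X
  map_comp f g := additiveExtensionHom_comp F f g

instance (F : C ⥤ D) : (additiveExtensionObj F).Additive where
  map_add {X Y f g} := by exact (additiveExtensionHom F X Y).map_add' f g

lemma additiveExtensionHom_naturality {F G : C ⥤ D} (α : F ⟶ G) (X Y : C) (f : (X ⟶ Y) →₀ ℤ) :
    additiveExtensionHom F X Y f ≫ α.app Y = α.app X ≫ additiveExtensionHom G X Y f := by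
  rw [additiveExtensionHom_apply, additiveExtensionHom_apply, Preadditive.sum_comp,
    Preadditive.comp_sum]
  simp only [Preadditive.zsmul_comp, Preadditive.comp_zsmul, α.naturality]

/-- The additive extension `F ↦ F_ad` as a functor in `F`. -/
def additiveExtension : (C ⥤ D) ⥤ (Free ℤ C ⥤+ D) where
  obj F := AdditiveFunctor.of (additiveExtensionObj F)
  map α := ObjectProperty.homMk
    { app X := α.app X
      naturality X Y f := additiveExtensionHom_naturality α X Y f }
  map_id _ := rfl
  map_comp _ _ := rfl

/-- `F_ad` restricts to `F` on `C`. -/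
lemma additiveExtensionObj_map_embedding (F : C ⥤ D) {X Y : C} (f : X ⟶ Y) :
    (additiveExtensionObj F).map ((Free.embedding ℤ C).map f) = F.map f :=
  (additiveExtensionHom_single F X Y f 1).trans (one_smul _ _)

end AdditiveExtension

/-! ## The normalized complex in the idempotent completion of `ℤC` -/

section Comparison

open Idempotents

variable (C : Type u) [Category.{v} C]

/-- The functor `C ⥤ ℤC` followed by the embedding of `ℤC` into its idempotent completion. -/
abbrev toKaroubiFree : C ⥤ Karoubi (Free ℤ C) :=
  Free.embedding ℤ C ⋙ toKaroubi (Free ℤ C)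

variable {C}

/-- `P`, regarded as a class of objects of `ℤC`. -/
abbrev inFree (P : ObjectProperty C) : ObjectProperty (Free ℤ C) :=
  P.strictMap (Free.embedding ℤ C)

/-- `P`, regarded as a class of objects of the idempotent completion of `ℤC`. -/
abbrev inKaroubiFree (P : ObjectProperty C) : ObjectProperty (Karoubi (Free ℤ C)) :=
  P.strictMap (toKaroubiFree C)

/-- The augmentation `N(X)_0 ⟶ Y` induced by a morphism `X_0 ⟶ Y`. -/
def normalizedAug {D : Type u'} [Category.{v'} D] [Preadditive D] [IsIdempotentComplete D]
    (X : PseudocubicalObject D) {Y : D} (ε : X.X 0 ⟶ Y) : X.normalized.X 0 ⟶ Y :=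
  X.normalizedι 0 ≫ ε

end Comparison

end CubicalDerived

end

open CubicalDerived

/-! Fix `Q` in `P` and a resolution `X ⟶ Y`. Homming out of `Q` turns `X` into a precubical set over
the set `Hom(Q, Y)`, and `P`-exactness says that every compatible family of prescribed faces has a
filler. After choosing a section `t` of `Hom(Q, X_0) → Hom(Q, Y)`, one fills degree by degree and
obtains a homotopy `h` from the identity to the endomorphism `collapse`, which factors through the
constant precubical set `Hom(Q, Y)` (`exists_contraction`).

Morphisms in `ℤC` are formal sums, so `h` extends linearly although it is not natural in `Q`. On a
cycle `y` killed by all the `∂_i^1`, the collapse vanishes, `h y` is again killed by all the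
`∂_i^1`, and the boundary of `h y` is `y - h(∂y) = y`. Morphisms killed by the `∂_i^1` are, in
positive degrees, exactly those that lift to `N(X)`, so `N(X) ⟶ Y` is acyclic for `P`, hence by
definition for the closure of `P`. The objects `N(X)_n` are retracts of `X_n` and therefore lie in
the closure. This is (i), `isResolution_normalized`.

Pseudocubical resolutions exist by covering cubical kernels with objects of `P`; the
pseudodegeneracies are lifts of the families of faces which the identities force on them.
Resolutions inside `ℤC` need another construction, because `N(X)` requires split idempotents and the
unnormalized cubical complex is not acyclic in general (a constant object has zero differential).
The alternating-sum complex of a presimplicial `P`-resolution serves instead: its terms are in `P`,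
and the same filling argument contracts it.

For the comparison, let `F̃` be the extension of `F_ad` to the idempotent completion. An additive
functor preserves the splitting of `σ`, so `F̃(N(X)) ≅ N(F(X))`. A `P`-resolution `S` in `ℤC`
remains a resolution for the closure in the idempotent completion, as the embedding is fully
faithful. Hence `N(X)` and `S` are two resolutions of the same object for the same class, and
`H_n(N(F(X))) ≅ H_n(F̃(N(X))) ≅ H_n(F̃(S)) ≅ H_n(F_ad(S))`. Each isomorphism is compatible with
lifts of morphisms and with natural transformations. -/

noncomputable section

namespace CubicalDerived

universe v u v' u'

/-! ### Hom groups of `ℤC` and linear extension of maps of sets -/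

section FreeHoms

variable {C : Type u} [Category.{v} C]

/-- The `ℤ`-linear extension of a map between sets of morphisms of `C`. -/
def freeHomMap {Q A Q' B : C} (g : (Q ⟶ A) → (Q' ⟶ B)) :
    ((Free.embedding ℤ C).obj Q ⟶ (Free.embedding ℤ C).obj A) →+
      ((Free.embedding ℤ C).obj Q' ⟶ (Free.embedding ℤ C).obj B) :=
  Finsupp.mapDomain.addMonoidHom (M := ℤ) g

lemma freeHomMap_map {Q A Q' B : C} (g : (Q ⟶ A) → (Q' ⟶ B)) (f : Q ⟶ A) :
    freeHomMap g ((Free.embedding ℤ C).map f) = (Free.embedding ℤ C).map (g f) :=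
  Finsupp.mapDomain_single

lemma freeHom_addHom_ext {Q A : C} {M : Type*} [AddCommGroup M]
    {φ ψ : ((Free.embedding ℤ C).obj Q ⟶ (Free.embedding ℤ C).obj A) →+ M}
    (h : ∀ f : Q ⟶ A, φ ((Free.embedding ℤ C).map f) = ψ ((Free.embedding ℤ C).map f)) :
    φ = ψ := by
  refine Finsupp.addHom_ext (M := ℤ) fun f r => ?_
  have e : Finsupp.single f r = r • Finsupp.single f (1 : ℤ) := by simp
  rw [e]
  exact (map_zsmul φ r _).trans ((congrArg (r • ·) (h f)).trans (map_zsmul ψ r _).symm)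

/-- Identities between maps of sets of morphisms extend linearly. -/
lemma freeHom_induction {Q A : C} {M : Type*} [AddCommGroup M]
    (φ ψ : ((Free.embedding ℤ C).obj Q ⟶ (Free.embedding ℤ C).obj A) →+ M)
    (h : ∀ f : Q ⟶ A, φ ((Free.embedding ℤ C).map f) = ψ ((Free.embedding ℤ C).map f))
    (y : (Free.embedding ℤ C).obj Q ⟶ (Free.embedding ℤ C).obj A) : φ y = ψ y := by
  rw [freeHom_addHom_ext h]

/-- Both sides are additive in `y`, so it suffices to compare them on morphisms of `C`. This
transports the relation between consecutive components of a set-level contraction to formal sums. -/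
lemma freeHomMap_comp {Q A Q' B : C} {A' B' : C} (g : (Q ⟶ A) → (Q' ⟶ B)) (b : B ⟶ B')
    (g' : (Q ⟶ A') → (Q' ⟶ B')) (a : A ⟶ A') (h : ∀ f, g f ≫ b = g' (f ≫ a))
    (y : (Free.embedding ℤ C).obj Q ⟶ (Free.embedding ℤ C).obj A) :
    freeHomMap g y ≫ (Free.embedding ℤ C).map b =
      freeHomMap g' (y ≫ (Free.embedding ℤ C).map a) := by
  refine freeHom_induction ((Preadditive.rightComp _ _).comp (freeHomMap g))
    ((freeHomMap g').comp (Preadditive.rightComp _ _)) (fun f => ?_) y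
  change freeHomMap g _ ≫ _ = freeHomMap g' (_ ≫ _)
  rw [freeHomMap_map, ← Functor.map_comp, ← Functor.map_comp, freeHomMap_map, h]

lemma freeHomMap_comp_eq {Q A B B' : C} (g : (Q ⟶ A) → (Q ⟶ B)) (b : B ⟶ B')
    (g' : (Q ⟶ A) → (Q ⟶ B')) (h : ∀ f, g f ≫ b = g' f)
    (y : (Free.embedding ℤ C).obj Q ⟶ (Free.embedding ℤ C).obj A) :
    freeHomMap g y ≫ (Free.embedding ℤ C).map b = freeHomMap g' y := by
  refine freeHom_induction ((Preadditive.rightComp _ _).comp (freeHomMap g))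
    (freeHomMap g') (fun f => ?_) y
  change freeHomMap g _ ≫ _ = _
  rw [freeHomMap_map, freeHomMap_map, ← Functor.map_comp, h]

lemma freeHomMap_id {Q A : C} (y : (Free.embedding ℤ C).obj Q ⟶ (Free.embedding ℤ C).obj A) :
    freeHomMap (fun f : Q ⟶ A => f) y = y :=
  freeHom_induction (freeHomMap fun f : Q ⟶ A => f) (AddMonoidHom.id _)
    (fun f => freeHomMap_map _ f) y

lemma freeHomMap_comp_eq_self {Q A B : C} (g : (Q ⟶ A) → (Q ⟶ B)) (b : B ⟶ A)
    (h : ∀ f, g f ≫ b = f)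
    (y : (Free.embedding ℤ C).obj Q ⟶ (Free.embedding ℤ C).obj A) :
    freeHomMap g y ≫ (Free.embedding ℤ C).map b = y :=
  (freeHomMap_comp_eq g b (fun f => f) h y).trans (freeHomMap_id y)

end FreeHoms

/-! ### Contracting the precubical set `Hom(Q, X)` -/

namespace AugmentedPseudocubicalObject

variable {C : Type u} [Category.{v} C] {Y : C} (X : AugmentedPseudocubicalObject Y)

/-- The composite of an iterated face `X_n ⟶ X_0` with the augmentation. -/
def totalAug : ∀ n : ℕ, X.X n ⟶ Y
  | 0 => X.aug
  | n + 1 => X.d n 0 true ≫ totalAug n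

/-- By induction `∂_1^1` may be taken as the next face, and the face identities then move the given
face past it. -/
lemma d_totalAug (n : ℕ) (i : Fin (n + 1)) (a : Bool) :
    X.d n i a ≫ X.totalAug n = X.totalAug (n + 1) := by
  induction n generalizing a with
  | zero =>
    obtain rfl : i = 0 := by ext; omega
    cases a
    · exact X.aug_w
    · rfl
  | succ n ih =>
    -- The two ends of the first direction are compared through `∂_2^1`: `∂_1^1 ∂_1^e = ∂_1^e
    -- ∂_2^1`, where by induction `e` no longer matters after the augmentation.
    have h0 : ∀ e, X.d (n + 1) 0 e ≫ X.totalAug (n + 1) = X.totalAug (n + 2) := fun e => by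
      have h := X.d_d n 0 0 e true le_rfl
      rw [Fin.castSucc_zero] at h
      rw [← ih 0 true, ← Category.assoc, ← h, Category.assoc, ih 0 e]
      have h' := X.d_d n 0 0 true true le_rfl
      rw [Fin.castSucc_zero] at h'
      rw [← ih 0 true, ← Category.assoc, h', Category.assoc, ih 0 true]
      rfl
    refine Fin.cases (h0 a) (fun i => ?_) i
    have h := X.d_d n 0 i true a (Fin.zero_le _)
    rw [Fin.castSucc_zero] at h
    rw [← ih 0 true, ← Category.assoc, h, Category.assoc, ih i a]
    exact h0 true

/-- The iterated pseudodegeneracy `X_0 ⟶ X_n`. -/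
def iteratedS : ∀ n : ℕ, X.X 0 ⟶ X.X n
  | 0 => 𝟙 _
  | n + 1 => iteratedS n ≫ X.s n 0

/-- This makes `iteratedS` a precubical morphism from the constant object `X_0`: the face meets the
last `s_1` and either cancels it or passes to a lower degree. -/
lemma iteratedS_d (n : ℕ) (i : Fin (n + 1)) (a : Bool) :
    X.iteratedS (n + 1) ≫ X.d n i a = X.iteratedS n := by
  induction n with
  | zero =>
    obtain rfl : i = 0 := by ext; omega
    change (_ ≫ _) ≫ _ = _
    rw [Category.assoc, X.s_d_self, Category.comp_id]
  | succ n ih =>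
    change (_ ≫ X.s (n + 1) 0) ≫ _ = _
    rw [Category.assoc]
    refine Fin.cases ?_ (fun i => ?_) i
    · rw [X.s_d_self, Category.comp_id]
    · have h := X.s_d_gt n i 0 a (Fin.zero_le _)
      rw [Fin.castSucc_zero] at h
      rw [h, ← Category.assoc, ih]
      rfl

section Contraction

variable {Q : C} (t : (Q ⟶ Y) → (Q ⟶ X.X 0))

/-- The endomorphism of the precubical set `Hom(Q, X)` obtained from a section `t` of
`Hom(Q, X_0) → Hom(Q, Y)`. -/
def collapse (n : ℕ) (x : Q ⟶ X.X n) : Q ⟶ X.X n :=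
  t (x ≫ X.totalAug n) ≫ X.iteratedS n

/-- The collapse passes through the constant precubical set `Hom(Q, Y)`, so no property of `t` is
involved. -/
lemma collapse_d (n : ℕ) (i : Fin (n + 1)) (a : Bool) (x : Q ⟶ X.X (n + 1)) :
    X.collapse t (n + 1) x ≫ X.d n i a = X.collapse t n (x ≫ X.d n i a) := by
  rw [collapse, collapse, Category.assoc, iteratedS_d, Category.assoc, d_totalAug]

/-- The linear extension factors through composition with `totalAug`, because the collapse does so
on sets. -/
lemma freeHomMap_collapse (n : ℕ)
    (y : (Free.embedding ℤ C).obj Q ⟶ (Free.embedding ℤ C).obj (X.X n))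
    (hy : y ≫ (Free.embedding ℤ C).map (X.totalAug n) = 0) :
    freeHomMap (X.collapse t n) y = 0 := by
  have h : freeHomMap (X.collapse t n) y =
      freeHomMap (fun u => t u ≫ X.iteratedS n) (y ≫ (Free.embedding ℤ C).map (X.totalAug n)) := by
    refine freeHom_induction (freeHomMap (X.collapse t n))
      ((freeHomMap _).comp (Preadditive.rightComp _ _)) (fun f => ?_) y
    change _ = freeHomMap _ (_ ≫ _)
    rw [freeHomMap_map, ← Functor.map_comp, freeHomMap_map]
    rfl
  rw [h, hy, map_zero]

/-- Two consecutive components of a homotopy between the identity of `Hom(Q, X)` and the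
endomorphism `X.collapse t`. -/
def ContractionPair (n : ℕ) : Type v :=
  { p : ((Q ⟶ X.X n) → (Q ⟶ X.X (n + 1))) × ((Q ⟶ X.X (n + 1)) → (Q ⟶ X.X (n + 2))) //
    (∀ x, p.1 x ≫ X.d n 0 false = x ∧ p.1 x ≫ X.d n 0 true = X.collapse t n x) ∧
    (∀ x, p.2 x ≫ X.d (n + 1) 0 false = x ∧
      p.2 x ≫ X.d (n + 1) 0 true = X.collapse t (n + 1) x) ∧
    ∀ x i a, p.2 x ≫ X.d (n + 1) i.succ a = p.1 (x ≫ X.d n i a) }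

/-- The faces prescribed for the value at `x` of the next component of a contraction. -/
def contractionFaces (n : ℕ) (h : (Q ⟶ X.X n) → (Q ⟶ X.X (n + 1))) (x : Q ⟶ X.X (n + 1))
    (i : Fin (n + 2)) (a : Bool) : Q ⟶ X.X (n + 1) :=
  Fin.cases (bif a then X.collapse t (n + 1) x else x) (fun i => h (x ≫ X.d n i a)) i

variable {X t} [HasFiniteLimits C] {P : ObjectProperty C}

/-- Degrees 0 and 1 are treated apart because the filler in `X_1` comes from the pullback over `Y`
rather than from a cubical kernel. -/
lemma exists_contractionPair_zero (hX : X.IsExact P) (hQ : P Q) (ht : ∀ y, t y ≫ X.aug = y) :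
    Nonempty (X.ContractionPair t 0) := by
  have e₀ : ∀ x : Q ⟶ X.X 0, ∃ z : Q ⟶ X.X 1,
      ∀ a, z ≫ X.d 0 0 a = bif a then X.collapse t 0 x else x := fun x =>
    hX.lift_one hQ _ (by
      -- The prescribed ends `x` and `collapse x` have the same augmentation since `t` is a section.
      change x ≫ _ = (t (x ≫ X.aug) ≫ 𝟙 _) ≫ X.aug
      rw [Category.comp_id, ht])
  choose h₀ hh₀ using e₀
  have e₁ : ∀ x : Q ⟶ X.X 1, ∃ z : Q ⟶ X.X 2,
      ∀ i a, z ≫ X.d 1 i a = X.contractionFaces t 0 h₀ x i a := fun x =>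
    hX.lift_succ hQ 0 _ (by
      intro i j a e _
      obtain rfl : i = 0 := by ext; omega
      obtain rfl : j = 0 := by ext; omega
      change h₀ _ ≫ _ = (bif a then X.collapse t 1 x else x) ≫ _
      rw [hh₀]
      cases a
      · rfl
      · exact (X.collapse_d t 0 0 e x).symm)
  choose h₁ hh₁ using e₁
  exact ⟨⟨(h₀, h₁), fun x => ⟨hh₀ x false, hh₀ x true⟩, fun x => ⟨hh₁ x 0 false, hh₁ x 0 true⟩,
    fun x i a => hh₁ x i.succ a⟩⟩

/-- The value at `x` is a filler of `contractionFaces`. Compatibility with the first direction is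
the endpoint condition on the previous component together with `collapse_d`; between the other
directions it is the face identity for `x`, and this uses how the two components of the pair are
related. -/
lemma ContractionPair.exists_succ (hX : X.IsExact P) (hQ : P Q) {n : ℕ}
    (p : X.ContractionPair t n) : ∃ q : X.ContractionPair t (n + 1), q.1.1 = p.1.2 := by
  have e : ∀ x : Q ⟶ X.X (n + 2), ∃ z : Q ⟶ X.X (n + 3),
      ∀ i a, z ≫ X.d (n + 2) i a = X.contractionFaces t (n + 1) p.1.2 x i a := fun x =>
    hX.lift_succ hQ (n + 1) _ (by
      intro i j a e hij
      change p.1.2 _ ≫ _ = _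
      revert hij
      refine Fin.cases ?_ (fun i => ?_) i
      · intro _
        change _ = (bif a then X.collapse t (n + 2) x else x) ≫ _
        cases a
        · exact (p.2.2.1 _).1
        · exact (p.2.2.1 _).2.trans (X.collapse_d t (n + 1) j e x).symm
      · refine Fin.cases (fun h => ?_) (fun j hij => ?_) j
        · exact absurd h (by simp)
        · change _ = p.1.2 (x ≫ X.d (n + 1) i.castSucc a) ≫ _
          rw [p.2.2.2, p.2.2.2, Category.assoc, Category.assoc,
            X.d_d n i j a e (Fin.succ_le_succ_iff.1 hij)])
  choose h hh using e
  exact ⟨⟨(p.1.2, h), p.2.2.1, fun x => ⟨hh x 0 false, hh x 0 true⟩,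
    fun x i a => hh x i.succ a⟩, rfl⟩

/-- If `X ⟶ Y` is `P`-exact and `Q` is in `P`, then the identity of the precubical set
`Hom(Q, X)` is homotopic to an endomorphism which factors through the constant
precubical set `Hom(Q, Y)`. -/
lemma exists_contraction (hX : X.IsExact P) (hQ : P Q) (ht : ∀ y, t y ≫ X.aug = y) :
    ∃ h : ∀ n, (Q ⟶ X.X n) → (Q ⟶ X.X (n + 1)),
      (∀ n x, h n x ≫ X.d n 0 false = x) ∧
      (∀ n x, h n x ≫ X.d n 0 true = X.collapse t n x) ∧
      ∀ n i a x, h (n + 1) x ≫ X.d (n + 1) i.succ a = h n (x ≫ X.d n i a) := by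
  obtain ⟨p₀⟩ := exists_contractionPair_zero hX hQ ht
  choose next hnext using fun (n : ℕ) (p : X.ContractionPair t n) => p.exists_succ hX hQ
  -- Consecutive pairs overlap by `hnext`, so their first components form one coherent family.
  let seq : ∀ n, X.ContractionPair t n := fun n => Nat.rec p₀ next n
  refine ⟨fun n => (seq n).1.1, fun n x => ((seq n).2.1 x).1, fun n x => ((seq n).2.1 x).2,
    fun n i a x => ?_⟩
  have h : (seq (n + 1)).1.1 = (seq n).1.2 := hnext n (seq n)
  exact (congrFun h x ▸ (seq n).2.2.2 x i a :)

end Contraction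

/-! ### Exactness of the normalized cycles in `Hom(Q, ℤX)` -/

section FreeExactness

open PseudocubicalObject

variable {X} {Q : C} [HasFiniteLimits C] {P : ObjectProperty C}

lemma IsExact.exists_section (hX : X.IsExact P) (hQ : P Q) :
    ∃ t : (Q ⟶ Y) → (Q ⟶ X.X 0), ∀ y, t y ≫ X.aug = y :=
  ⟨fun y => (hX.zero Q hQ y).choose, fun y => (hX.zero Q hQ y).choose_spec⟩

lemma IsExact.free_surjective (hX : X.IsExact P) (hQ : P Q)
    (y : (Free.embedding ℤ C).obj Q ⟶ (Free.embedding ℤ C).obj Y) :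
    ∃ z : (Free.embedding ℤ C).obj Q ⟶ (Free.embedding ℤ C).obj (X.X 0),
      z ≫ (Free.embedding ℤ C).map X.aug = y := by
  obtain ⟨t, ht⟩ := hX.exists_section hQ
  exact ⟨freeHomMap t y, freeHomMap_comp_eq_self t _ ht y⟩

/-- The filler `h y` has `∂_1^0` equal to `y` and `∂_1^1` equal to the collapse of `y`, which
vanishes since `y` has augmentation zero. -/
lemma IsExact.free_exact_zero (hX : X.IsExact P) (hQ : P Q)
    (y : (Free.embedding ℤ C).obj Q ⟶ (X.toPseudocubicalObject.map (Free.embedding ℤ C)).X 0)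
    (hy : y ≫ (Free.embedding ℤ C).map X.aug = 0) :
    ∃ z : (Free.embedding ℤ C).obj Q ⟶ (X.toPseudocubicalObject.map (Free.embedding ℤ C)).X 1,
      (∀ i, z ≫ (X.toPseudocubicalObject.map (Free.embedding ℤ C)).d 0 i true = 0) ∧
      z ≫ (X.toPseudocubicalObject.map (Free.embedding ℤ C)).objD 0 = y := by
  obtain ⟨t, ht⟩ := hX.exists_section hQ
  obtain ⟨h, h0, h1, -⟩ := exists_contraction hX hQ ht
  let z : (Free.embedding ℤ C).obj Q ⟶
    (X.toPseudocubicalObject.map (Free.embedding ℤ C)).X 1 := freeHomMap (h 0) y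
  have H : ∀ i : Fin 1, z ≫ (X.toPseudocubicalObject.map (Free.embedding ℤ C)).d 0 i true = 0 := by
    intro i
    obtain rfl : i = 0 := by ext; omega
    exact (freeHomMap_comp_eq (h 0) (X.d 0 0 true) _ (h1 0) y).trans
      (X.freeHomMap_collapse t 0 y hy)
  refine ⟨z, H, ?_⟩
  rw [comp_objD_of_d_true _ _ _ H, Fin.sum_univ_succ, Fin.sum_univ_zero, add_zero, Fin.val_zero,
    pow_zero, one_smul]
  exact freeHomMap_comp_eq_self (h 0) _ (h0 0) y

/-- The preimage is `h y`: its first pair of faces is `(y, 0)` and its other faces are `h` applied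
to the faces of `y`, so its boundary is `y - h(∂y)`. -/
lemma IsExact.free_exact_succ (hX : X.IsExact P) (hQ : P Q) (n : ℕ)
    (y : (Free.embedding ℤ C).obj Q ⟶
      (X.toPseudocubicalObject.map (Free.embedding ℤ C)).X (n + 1))
    (hy : ∀ i, y ≫ (X.toPseudocubicalObject.map (Free.embedding ℤ C)).d n i true = 0)
    (hy' : y ≫ (X.toPseudocubicalObject.map (Free.embedding ℤ C)).objD n = 0) :
    ∃ z : (Free.embedding ℤ C).obj Q ⟶
        (X.toPseudocubicalObject.map (Free.embedding ℤ C)).X (n + 2),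
      (∀ i, z ≫ (X.toPseudocubicalObject.map (Free.embedding ℤ C)).d (n + 1) i true = 0) ∧
      z ≫ (X.toPseudocubicalObject.map (Free.embedding ℤ C)).objD (n + 1) = y := by
  obtain ⟨t, ht⟩ := hX.exists_section hQ
  obtain ⟨h, h0, h1, h2⟩ := exists_contraction hX hQ ht
  let z : (Free.embedding ℤ C).obj Q ⟶
    (X.toPseudocubicalObject.map (Free.embedding ℤ C)).X (n + 2) := freeHomMap (h (n + 1)) y
  let L : ((Free.embedding ℤ C).obj Q ⟶
      (X.toPseudocubicalObject.map (Free.embedding ℤ C)).X n) →+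
    ((Free.embedding ℤ C).obj Q ⟶
      (X.toPseudocubicalObject.map (Free.embedding ℤ C)).X (n + 1)) := freeHomMap (h n)
  have key : ∀ (i : Fin (n + 1)) (a : Bool),
      z ≫ (X.toPseudocubicalObject.map (Free.embedding ℤ C)).d (n + 1) i.succ a =
        L (y ≫ (X.toPseudocubicalObject.map (Free.embedding ℤ C)).d n i a) := fun i a =>
    freeHomMap_comp _ _ _ _ (h2 n i a) y
  have key₀ : z ≫ (X.toPseudocubicalObject.map (Free.embedding ℤ C)).d (n + 1) 0 false = y :=
    freeHomMap_comp_eq_self _ _ (h0 (n + 1)) y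
  -- In positive degree `totalAug` starts with `∂_1^1`, which already kills `y`.
  have hy₀ : y ≫ (Free.embedding ℤ C).map (X.totalAug (n + 1)) = 0 := by
    exact (congrArg (y ≫ ·) ((Free.embedding ℤ C).map_comp (X.d n 0 true) (X.totalAug n))).trans
      ((Category.assoc _ _ _).symm.trans
        ((congrArg (· ≫ (Free.embedding ℤ C).map (X.totalAug n)) (hy 0)).trans zero_comp))
  have H : ∀ i, z ≫ (X.toPseudocubicalObject.map (Free.embedding ℤ C)).d (n + 1) i true = 0 := by
    refine Fin.cases ?_ fun i => ?_
    · exact (freeHomMap_comp_eq (h (n + 1)) (X.d (n + 1) 0 true) _ (h1 (n + 1)) y).trans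
        (X.freeHomMap_collapse t (n + 1) y hy₀)
    · rw [key, hy, map_zero]
  refine ⟨z, H, ?_⟩
  rw [comp_objD_of_d_true _ _ _ hy] at hy'
  rw [comp_objD_of_d_true _ _ _ H, Fin.sum_univ_succ, Fin.val_zero, pow_zero, one_smul, key₀]
  -- The index shift from `i` to `i.succ` gives the sign that turns the remaining faces into
  -- `-h(∂y)`.
  have hL : ∑ i : Fin (n + 1), (-1 : ℤ) ^ (i.succ : ℕ) •
      (z ≫ (X.toPseudocubicalObject.map (Free.embedding ℤ C)).d (n + 1) i.succ false) =
      - L (∑ i : Fin (n + 1), (-1 : ℤ) ^ (i : ℕ) •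
        (y ≫ (X.toPseudocubicalObject.map (Free.embedding ℤ C)).d n i false)) := by
    rw [map_sum, ← Finset.sum_neg_distrib]
    refine Finset.sum_congr rfl fun i _ => ?_
    rw [key, map_zsmul, Fin.val_succ, pow_succ, mul_neg_one, neg_smul]
  rw [hL, hy', map_zero, neg_zero, add_zero]

end FreeExactness

end AugmentedPseudocubicalObject

/-! ### Additive functors commute with normalization -/

namespace PseudocubicalObject

section MapAdditive

variable {D : Type u} [Category.{v} D] [Preadditive D] {E : Type u'} [Category.{v'} E]
  [Preadditive E] (G : D ⥤ E) [G.Additive] (X : PseudocubicalObject D)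

lemma map_objD (n : ℕ) : (X.map G).objD n = G.map (X.objD n) := by
  unfold objD
  rw [G.map_sum]
  refine Finset.sum_congr rfl fun i _ => ?_
  rw [G.map_zsmul, G.map_sub]
  rfl

lemma map_sigmaAux (n k : ℕ) (hk : k ≤ n + 1) :
    (X.map G).sigmaAux n k hk = G.map (X.sigmaAux n k hk) := by
  induction k with
  | zero =>
    rw [sigmaAux_zero, sigmaAux_zero]
    exact (G.map_id _).symm
  | succ k ih =>
    rw [sigmaAux_succ, sigmaAux_succ, ih, G.map_comp, G.map_sub, G.map_comp, G.map_id]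
    rfl

lemma map_sigma (n : ℕ) : (X.map G).sigma n = G.map (X.sigma n) := by
  cases n with
  | zero => exact (G.map_id _).symm
  | succ n => exact X.map_sigmaAux G n (n + 1) le_rfl

/-- A morphism annihilated by the faces `∂_i^1` in positive degrees lifts to `N(X)`. -/
lemma exists_normalizedLift [IsIdempotentComplete D] {T : D} (n : ℕ) (x : T ⟶ X.X (n + 1))
    (hx : ∀ i, x ≫ X.d n i true = 0) :
    ∃ z : T ⟶ X.normalized.X (n + 1), z ≫ X.normalizedι (n + 1) = x :=
  ⟨X.normalizedLift (n + 1) x (X.comp_sigma n x hx), X.normalizedLift_ι _ _ _⟩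

/-- The projection `X_n ⟶ N(X)_n`. -/
def normalizedπ [IsIdempotentComplete D] (n : ℕ) : X.X n ⟶ X.normalized.X n :=
  X.normalizedLift n (X.sigma n) (X.sigma_idem n)

lemma normalizedπ_ι [IsIdempotentComplete D] (n : ℕ) :
    X.normalizedπ n ≫ X.normalizedι n = X.sigma n :=
  X.normalizedLift_ι _ _ _

lemma normalizedι_π [IsIdempotentComplete D] (n : ℕ) :
    X.normalizedι n ≫ X.normalizedπ n = 𝟙 _ := by
  rw [← cancel_mono (X.normalizedι n), Category.assoc, normalizedπ_ι, normalizedι_sigma,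
    Category.id_comp]

variable [IsIdempotentComplete D]

/-- The inclusion `G(N(X))_n ⟶ G(X)_n`. -/
def mapNormalizedι (n : ℕ) :
    ((G.mapHomologicalComplex (ComplexShape.down ℕ)).obj X.normalized).X n ⟶ (X.map G).X n :=
  G.map (X.normalizedι n)

/-- The projection `G(X)_n ⟶ G(N(X))_n`. -/
def mapNormalizedπ (n : ℕ) :
    (X.map G).X n ⟶ ((G.mapHomologicalComplex (ComplexShape.down ℕ)).obj X.normalized).X n :=
  G.map (X.normalizedπ n)

lemma mapNormalizedι_π (n : ℕ) : X.mapNormalizedι G n ≫ X.mapNormalizedπ G n = 𝟙 _ :=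
  (G.map_comp _ _).symm.trans ((congrArg G.map (X.normalizedι_π n)).trans (G.map_id _))

lemma mapNormalizedπ_ι (n : ℕ) :
    X.mapNormalizedπ G n ≫ X.mapNormalizedι G n = (X.map G).sigma n := by
  rw [map_sigma]
  exact (G.map_comp _ _).symm.trans (congrArg G.map (X.normalizedπ_ι n))

lemma mapNormalizedι_sigma (n : ℕ) :
    X.mapNormalizedι G n ≫ (X.map G).sigma n = X.mapNormalizedι G n := by
  rw [← mapNormalizedπ_ι, ← Category.assoc, mapNormalizedι_π, Category.id_comp]

lemma mapNormalized_d_ι (n : ℕ) :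
    ((G.mapHomologicalComplex (ComplexShape.down ℕ)).obj X.normalized).d (n + 1) n ≫
      X.mapNormalizedι G n = X.mapNormalizedι G (n + 1) ≫ (X.map G).objD n := by
  rw [map_objD]
  exact (G.map_comp _ _).symm.trans ((congrArg G.map (X.normalized_d_ι n)).trans
    (G.map_comp _ _))

variable [IsIdempotentComplete E]

/-- The comparison morphism `G(N(X)) ⟶ N(G(X))` for an additive functor `G`. -/
def normalizedComparison :
    (G.mapHomologicalComplex _).obj X.normalized ⟶ (X.map G).normalized where
  f n := (X.map G).normalizedLift n (X.mapNormalizedι G n) (X.mapNormalizedι_sigma G n)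
  comm' i j hij := by
    obtain rfl : j + 1 = i := hij
    rw [← cancel_mono ((X.map G).normalizedι j), Category.assoc, normalized_d_ι,
      ← Category.assoc, normalizedLift_ι, Category.assoc, normalizedLift_ι, mapNormalized_d_ι]

lemma normalizedComparison_f_ι (n : ℕ) :
    (X.normalizedComparison G).f n ≫ (X.map G).normalizedι n = X.mapNormalizedι G n :=
  (X.map G).normalizedLift_ι n _ (X.mapNormalizedι_sigma G n)

/-- In each degree source and target split the same idempotent `G(σ_n)`: an additive functor
preserves the splitting of `σ_n`, whether or not it preserves kernels. -/
instance : IsIso (X.normalizedComparison G) := by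
  have : ∀ n, IsIso ((X.normalizedComparison G).f n) := fun n => by
    refine ⟨(X.map G).normalizedι n ≫ X.mapNormalizedπ G n, ?_, ?_⟩
    · rw [← Category.assoc, normalizedComparison_f_ι, mapNormalizedι_π]
    · rw [← cancel_mono ((X.map G).normalizedι n), Category.assoc, normalizedComparison_f_ι,
        Category.assoc, mapNormalizedπ_ι, normalizedι_sigma, Category.id_comp]
  exact HomologicalComplex.Hom.isIso_of_components _

lemma normalizedComparison_naturality {X Y : PseudocubicalObject D} (φ : PreHom X Y) :
    (G.mapHomologicalComplex _).map (normalizedMap φ) ≫ Y.normalizedComparison G =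
      X.normalizedComparison G ≫ normalizedMap (φ.map G) := by
  ext n
  rw [← cancel_mono ((Y.map G).normalizedι n), HomologicalComplex.comp_f,
    HomologicalComplex.comp_f, Category.assoc, Category.assoc, normalizedComparison_f_ι,
    normalizedMap_f_ι, ← Category.assoc, normalizedComparison_f_ι]
  exact (G.map_comp _ _).symm.trans ((congrArg G.map (normalizedMap_f_ι φ n)).trans
    (G.map_comp _ _))

lemma normalizedComparison_natTrans {G G' : D ⥤ E} [G.Additive] [G'.Additive] (β : G ⟶ G')
    (X : PseudocubicalObject D) :
    (NatTrans.mapHomologicalComplex β _).app X.normalized ≫ X.normalizedComparison G' =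
      X.normalizedComparison G ≫ normalizedMap (PreHom.ofNatTrans β X) := by
  ext n
  rw [← cancel_mono ((X.map G').normalizedι n), HomologicalComplex.comp_f,
    HomologicalComplex.comp_f, Category.assoc, Category.assoc, normalizedComparison_f_ι,
    normalizedMap_f_ι, ← Category.assoc, normalizedComparison_f_ι]
  exact (β.naturality _).symm

end MapAdditive

end PseudocubicalObject

/-! ### Acyclicity with respect to the closure of a class -/

section Closure

variable {A : Type u} [Category.{v} A] [Preadditive A] {P : ObjectProperty A}

lemma le_exactClosure : P ≤ exactClosure P := fun Q hQ _ _ _ _ _ h => h.2 Q hQ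

/-- The closure of a class of objects is closed under retracts. -/
lemma exactClosure_of_retract {Q R : A} (i : Q ⟶ R) (r : R ⟶ Q) (h : i ≫ r = 𝟙 Q)
    (hR : exactClosure P R) : exactClosure P Q := by
  intro X Y Z f g hfg y
  constructor
  · intro hy
    have hy' : y ≫ g = 0 := hy
    -- The lifting problem is moved to `R` along `r`, solved there, and its solution restricted
    -- along `i`.
    obtain ⟨x, hx⟩ := (hR f g hfg (r ≫ y)).1 (by
      change (r ≫ y) ≫ g = 0
      rw [Category.assoc, hy', comp_zero])
    have hx' : x ≫ f = r ≫ y := hx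
    refine ⟨i ≫ x, ?_⟩
    change (i ≫ x) ≫ f = y
    rw [Category.assoc, hx', ← Category.assoc, h, Category.id_comp]
  · rintro ⟨x, rfl⟩
    change (x ≫ f) ≫ g = 0
    rw [Category.assoc, hfg.1, comp_zero]

/-- A complex which is acyclic with respect to `P` is acyclic with respect to the closure. -/
lemma IsAcyclic.exactClosure {K : ChainComplex A ℕ} {Y : A} {ε : K.X 0 ⟶ Y}
    (h : IsAcyclic P K ε) : IsAcyclic (exactClosure P) K ε where
  d_aug := h.d_aug
  surjective Q hQ y := by
    -- The closure only speaks of three-term sequences. Surjectivity onto `Hom(Q, Y)` is encoded as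
    -- exactness at `Y`, with the zero endomorphism of `Y` as second map since a zero object need
    -- not exist.
    have h' : IsPExact P ε (0 : Y ⟶ Y) := ⟨comp_zero, fun Q hQ y =>
      ⟨fun _ => h.surjective Q hQ y, fun _ => comp_zero⟩⟩
    exact (hQ ε 0 h' y).1 comp_zero
  exact_zero Q hQ := hQ _ _ ⟨h.d_aug, h.exact_zero⟩
  exact_succ n Q hQ := hQ _ _ ⟨K.d_comp_d _ _ _, h.exact_succ n⟩

variable {A' : Type u'} [Category.{v'} A'] [Preadditive A']

/-- Fully faithful additive functors preserve acyclicity. -/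
lemma IsAcyclic.map {K : ChainComplex A ℕ} {Y : A} {ε : K.X 0 ⟶ Y} (h : IsAcyclic P K ε)
    (G : A ⥤ A') [G.Additive] [G.Full] [G.Faithful] :
    IsAcyclic (P.strictMap G) ((G.mapHomologicalComplex _).obj K) (G.map ε) := by
  have key : ∀ {Q U V W : A} (f : U ⟶ V) (g : V ⟶ W),
      Function.Exact (fun x : Q ⟶ U => x ≫ f) (fun y : Q ⟶ V => y ≫ g) →
      Function.Exact (fun x : G.obj Q ⟶ G.obj U => x ≫ G.map f)
        (fun y : G.obj Q ⟶ G.obj V => y ≫ G.map g) := by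
    intro Q U V W f g hfg y
    obtain ⟨y, rfl⟩ := G.map_surjective y
    change G.map y ≫ G.map g = 0 ↔ _
    rw [← G.map_comp, G.map_eq_zero_iff]
    refine (hfg y).trans ⟨?_, ?_⟩
    · rintro ⟨x, rfl⟩
      exact ⟨G.map x, (G.map_comp _ _).symm⟩
    · rintro ⟨x, hx⟩
      obtain ⟨x, rfl⟩ := G.map_surjective x
      exact ⟨x, G.map_injective ((G.map_comp _ _).trans hx)⟩
  constructor
  · exact (G.map_comp _ _).symm.trans ((congrArg G.map h.d_aug).trans (G.map_zero _ _))
  · rintro _ ⟨Q, hQ⟩ y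
    obtain ⟨y, rfl⟩ := G.map_surjective y
    obtain ⟨x, rfl⟩ := h.surjective Q hQ y
    exact ⟨G.map x, (G.map_comp _ _).symm⟩
  · rintro _ ⟨Q, hQ⟩
    exact key _ _ (h.exact_zero Q hQ)
  · rintro n _ ⟨Q, hQ⟩
    exact key _ _ (h.exact_succ n Q hQ)

end Closure

/-! ### From exactness on the kernel of the `∂_i^1` to acyclicity of `N(X)` -/

section NormalizedAcyclic

open PseudocubicalObject

variable {E : Type u'} [Category.{v'} E] [Preadditive E]

/-- Every morphism from `Q` to `X_n` which is a cycle of the subcomplex of the morphisms annihilated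
by the faces `∂_i^1` is a boundary of that subcomplex. -/
structure IsNormalizedExactAt (X : PseudocubicalObject E) {Y : E} (ε : X.X 0 ⟶ Y) (Q : E) :
    Prop where
  surjective : ∀ y : Q ⟶ Y, ∃ z : Q ⟶ X.X 0, z ≫ ε = y
  exact_zero : ∀ y : Q ⟶ X.X 0, y ≫ ε = 0 →
    ∃ z : Q ⟶ X.X 1, (∀ i, z ≫ X.d 0 i true = 0) ∧ z ≫ X.objD 0 = y
  exact_succ : ∀ (n : ℕ) (y : Q ⟶ X.X (n + 1)), (∀ i, y ≫ X.d n i true = 0) →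
    y ≫ X.objD n = 0 →
    ∃ z : Q ⟶ X.X (n + 2), (∀ i, z ≫ X.d (n + 1) i true = 0) ∧ z ≫ X.objD (n + 1) = y

lemma objD_aug (X : PseudocubicalObject E) {Y : E} (ε : X.X 0 ⟶ Y)
    (hε : X.d 0 0 false ≫ ε = X.d 0 0 true ≫ ε) : X.objD 0 ≫ ε = 0 := by
  rw [objD, Fin.sum_univ_succ, Fin.sum_univ_zero, add_zero, Preadditive.zsmul_comp,
    Preadditive.sub_comp, hε, sub_self, smul_zero]

/-- In positive degrees a morphism lifts along the monomorphism `normalizedι` exactly when all the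
`∂_i^1` kill it; in degree 0 there is no condition, as `σ_0` is the identity. Every equation can
therefore be checked in `X`. -/
lemma isAcyclic_normalized [IsIdempotentComplete E] {P : ObjectProperty E}
    {X : PseudocubicalObject E} {Y : E} {ε : X.X 0 ⟶ Y}
    (hε : X.d 0 0 false ≫ ε = X.d 0 0 true ≫ ε) (h : ∀ Q, P Q → IsNormalizedExactAt X ε Q) :
    IsAcyclic P X.normalized (normalizedAug X ε) := by
  have hd : X.normalized.d 1 0 ≫ normalizedAug X ε = 0 := by
    change _ ≫ X.normalizedι 0 ≫ ε = 0
    rw [← Category.assoc, normalized_d_ι, Category.assoc, objD_aug X ε hε, comp_zero]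
  constructor
  · exact hd
  · intro Q hQ y
    obtain ⟨x, hx⟩ := (h Q hQ).surjective y
    have h₀ : x ≫ X.sigma 0 = x := Category.comp_id _
    refine ⟨X.normalizedLift 0 x h₀, ?_⟩
    change _ ≫ X.normalizedι 0 ≫ ε = _
    rw [← Category.assoc, normalizedLift_ι, hx]
  · intro Q hQ y
    constructor
    · intro hy
      have hy' : y ≫ X.normalizedι 0 ≫ ε = 0 := hy
      obtain ⟨z, hz, hz'⟩ := (h Q hQ).exact_zero (y ≫ X.normalizedι 0) (by
        rw [Category.assoc, hy'])
      obtain ⟨z', h'⟩ := X.exists_normalizedLift 0 z hz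
      refine ⟨z', ?_⟩
      change z' ≫ _ = y
      rw [← cancel_mono (X.normalizedι 0), Category.assoc, normalized_d_ι, ← Category.assoc, h',
        hz']
    · rintro ⟨x, rfl⟩
      change (x ≫ _) ≫ _ = 0
      rw [Category.assoc, hd, comp_zero]
  · intro n Q hQ y
    constructor
    · intro hy
      have hy' : y ≫ X.normalized.d (n + 1) n = 0 := hy
      obtain ⟨z, hz, hz'⟩ := (h Q hQ).exact_succ n (y ≫ X.normalizedι (n + 1))
        (fun i => by rw [Category.assoc, normalizedι_d_true, comp_zero])
        (by rw [Category.assoc, ← normalized_d_ι, ← Category.assoc, hy', zero_comp])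
      obtain ⟨z', h'⟩ := X.exists_normalizedLift (n + 1) z hz
      refine ⟨z', ?_⟩
      change z' ≫ _ = y
      rw [← cancel_mono (X.normalizedι (n + 1)), Category.assoc, normalized_d_ι,
        ← Category.assoc, h', hz']
    · rintro ⟨x, rfl⟩
      change (x ≫ _) ≫ _ = 0
      rw [Category.assoc, HomologicalComplex.d_comp_d, comp_zero]

variable {D : Type u} [Category.{v} D] [Preadditive D]

/-- The middle object is given as `(X.map G).X (n + 1)`, equal to `G.obj (X.X (n + 1))` only after
unfolding, so that `map_objD` can be rewritten. -/
lemma map_comp_map_objD (G : D ⥤ E) [G.Additive] (X : PseudocubicalObject D) {Q : D} (n : ℕ)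
    (z : Q ⟶ X.X (n + 1)) :
    CategoryStruct.comp (Y := (X.map G).X (n + 1)) (G.map z) ((X.map G).objD n) =
      G.map (z ≫ X.objD n) := by
  rw [map_objD]
  exact (G.map_comp _ _).symm

/-- Every test morphism out of `G.obj Q` comes from one out of `Q`, and equations between images are
reflected. This passes from `ℤC` to its idempotent completion. -/
lemma IsNormalizedExactAt.map (G : D ⥤ E) [G.Additive] [G.Full] [G.Faithful]
    {X : PseudocubicalObject D} {Y : D} {ε : X.X 0 ⟶ Y} {Q : D} (h : IsNormalizedExactAt X ε Q) :
    IsNormalizedExactAt (X.map G) (G.map ε) (G.obj Q) := by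
  have zero : ∀ {U V : D} (y : Q ⟶ U) (f : U ⟶ V), G.map y ≫ G.map f = 0 → y ≫ f = 0 :=
    fun y f hyf => G.map_injective ((G.map_comp _ _).trans (hyf.trans (G.map_zero _ _).symm))
  have zero' : ∀ {U V : D} (y : Q ⟶ U) (f : U ⟶ V), y ≫ f = 0 → G.map y ≫ G.map f = 0 :=
    fun y f hyf => (G.map_comp _ _).symm.trans ((congrArg G.map hyf).trans (G.map_zero _ _))
  constructor
  · intro y
    obtain ⟨y, rfl⟩ := G.map_surjective y
    obtain ⟨z, rfl⟩ := h.surjective y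
    exact ⟨G.map z, (G.map_comp _ _).symm⟩
  · intro y hy
    obtain ⟨y, rfl⟩ := G.map_surjective y
    obtain ⟨z, hz, hz'⟩ := h.exact_zero y (zero _ _ hy)
    exact ⟨G.map z, fun i => zero' _ _ (hz i),
      (map_comp_map_objD G X 0 z).trans (congrArg G.map hz')⟩
  · intro n y hy hy'
    obtain ⟨y, rfl⟩ := G.map_surjective y
    obtain ⟨z, hz, hz'⟩ := h.exact_succ n y (fun i => zero _ _ (hy i))
      (G.map_injective ((map_comp_map_objD G X n y).symm.trans (hy'.trans (G.map_zero _ _).symm)))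
    exact ⟨G.map z, fun i => zero' _ _ (hz i),
      (map_comp_map_objD G X (n + 1) z).trans (congrArg G.map hz')⟩

end NormalizedAcyclic

/-! ### `N(X)` resolves `Y` in the idempotent completion -/

section NormalizedResolution

open PseudocubicalObject AugmentedPseudocubicalObject Idempotents

variable {C : Type u} [Category.{v} C] {P : ObjectProperty C}

lemma inKaroubiFree_eq : inKaroubiFree P = (inFree P).strictMap (toKaroubi (Free ℤ C)) := by
  ext Z
  constructor
  · rintro ⟨Q, hQ⟩
    exact ⟨_, Q, hQ⟩
  · rintro ⟨_, Q, hQ⟩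
    exact ⟨Q, hQ⟩

/-- The normalized complex of a `P`-projective pseudocubical resolution of `Y` in `C` is a
resolution of `Y` with respect to the closure of `P` in the idempotent completion of `ℤC`. -/
lemma PseudocubicalResolution.isResolution_normalized [HasFiniteLimits C] {Y : C} (X : PseudocubicalResolution P Y) :
    IsResolution (exactClosure (inKaroubiFree P))
      (X.toPseudocubicalObject.map (toKaroubiFree C)).normalized
      (normalizedAug (X.toPseudocubicalObject.map (toKaroubiFree C))
        ((toKaroubiFree C).map X.aug)) where
  toIsAcyclic := by
    -- Acyclicity need only be tested on `P` itself, where it reduces to formal sums of morphisms of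
    -- `C`.
    refine IsAcyclic.exactClosure ?_
    refine isAcyclic_normalized ?_ ?_
    · exact ((toKaroubiFree C).map_comp _ _).symm.trans
        ((congrArg _ X.aug_w).trans ((toKaroubiFree C).map_comp _ _))
    · rintro _ ⟨Q, hQ⟩
      exact IsNormalizedExactAt.map (toKaroubi (Free ℤ C))
        (X := X.toPseudocubicalObject.map (Free.embedding ℤ C))
        (ε := (Free.embedding ℤ C).map X.aug)
        ⟨X.exact.free_surjective hQ, X.exact.free_exact_zero hQ, X.exact.free_exact_succ hQ⟩
  -- `N(X)_n` is the image of `σ_n`, hence a retract of `X_n`; it need not belong to `P`, which is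
  -- why the closure appears.
  mem n := exactClosure_of_retract _ _
    ((X.toPseudocubicalObject.map (toKaroubiFree C)).normalizedι_π n)
    (le_exactClosure _ ⟨_, X.mem n⟩)

end NormalizedResolution

/-! ### Construction of pseudocubical resolutions -/

section Existence

variable {C : Type u} [Category.{v} C]

lemma cubicalKernel_condition [HasFiniteLimits C] {X Y : C} {n : ℕ}
    (f : Fin (n + 1) → Bool → (X ⟶ Y)) (i j : Fin (n + 1)) (a e : Bool) (h : i ≤ j) :
    cubicalKernelπ f j.succ e ≫ f i a = cubicalKernelπ f i.castSucc a ≫ f j e := by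
  have h' := congrArg (· ≫ Pi.π _ ⟨⟨(i, j), h⟩, a, e⟩) (equalizer.condition
    (Pi.lift fun p : { p : Fin (n + 1) × Fin (n + 1) // p.1 ≤ p.2 } × Bool × Bool =>
      Pi.π (fun _ : Fin (n + 2) × Bool => X) (p.1.1.2.succ, p.2.2) ≫ f p.1.1.1 p.2.1)
    (Pi.lift fun p : { p : Fin (n + 1) × Fin (n + 1) // p.1 ≤ p.2 } × Bool × Bool =>
      Pi.π (fun _ : Fin (n + 2) × Bool => X) (p.1.1.1.castSucc, p.2.1) ≫ f p.1.1.2 p.2.2))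
  simpa only [Category.assoc, Pi.lift_π, cubicalKernelπ] using h'

/-- Two consecutive objects of a pseudocubical object, with the faces and the pseudodegeneracies
between them. -/
structure CubicalStage (C : Type u) [Category.{v} C] (n : ℕ) where
  A : C
  B : C
  d : Fin (n + 1) → Bool → (B ⟶ A)
  s : Fin (n + 1) → (A ⟶ B)

namespace CubicalStage

variable {n : ℕ} (σ : CubicalStage C n)

/-- The composite `∂_j^a s_k` prescribed by the pseudocubical identities. -/
def faces (k j : Fin (n + 2)) (a : Bool) : σ.B ⟶ σ.B :=
  if h : j < k then
    σ.d (j.castPred (Fin.ne_last_of_lt h)) a ≫ σ.s (k.pred (Fin.ne_zero_of_lt h))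
  else if h' : k < j then
    σ.d (j.pred (Fin.ne_zero_of_lt h')) a ≫ σ.s (k.castPred (Fin.ne_last_of_lt h'))
  else 𝟙 _

lemma faces_lt (i k : Fin (n + 1)) (h : i ≤ k) (a : Bool) :
    σ.faces k.succ i.castSucc a = σ.d i a ≫ σ.s k := by
  have h' : i.castSucc < k.succ := Fin.castSucc_lt_succ_iff.2 h
  rw [faces, dif_pos h']
  simp

lemma faces_gt (i k : Fin (n + 1)) (h : k ≤ i) (a : Bool) :
    σ.faces k.castSucc i.succ a = σ.d i a ≫ σ.s k := by
  have h' : k.castSucc < i.succ := Fin.castSucc_lt_succ_iff.2 h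
  rw [faces, dif_neg h'.le.not_gt, dif_pos h']
  simp

lemma faces_self (k : Fin (n + 2)) (a : Bool) : σ.faces k k a = 𝟙 _ := by
  rw [faces, dif_neg (lt_irrefl _), dif_neg (lt_irrefl _)]

/-- The prescribed faces of the next pseudodegeneracies define morphisms to the cubical kernel. -/
def Compatible : Prop :=
  ∀ (k : Fin (n + 2)) (i j : Fin (n + 1)) (a e : Bool), i ≤ j →
    σ.faces k j.succ e ≫ σ.d i a = σ.faces k i.castSucc a ≫ σ.d j e

/-- The data extending `σ` by one more object of a pseudocubical object. -/
structure Extension where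
  B : C
  d : Fin (n + 2) → Bool → (B ⟶ σ.B)
  s : Fin (n + 2) → (σ.B ⟶ B)
  d_d : ∀ (i j : Fin (n + 1)) (a e : Bool), i ≤ j →
    d j.succ e ≫ σ.d i a = d i.castSucc a ≫ σ.d j e
  s_d : ∀ (k j : Fin (n + 2)) (a : Bool), s k ≫ d j a = σ.faces k j a

namespace Extension

variable {σ}

/-- The next two consecutive objects. -/
def stage (τ : σ.Extension) : CubicalStage C (n + 1) where
  A := σ.B
  B := τ.B
  d := τ.d
  s := τ.s

/-- This is the induction step that makes the next pseudodegeneracies liftable. When `k` is one of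
the two face indices, one side has an identity face and the other cancels `s ∂ = 1`. Otherwise both
sides become a double face followed by one lower pseudodegeneracy. -/
lemma compatible (τ : σ.Extension) : τ.stage.Compatible := by
  obtain ⟨A, B, d, s⟩ := σ
  obtain ⟨B'', d', s', d_d, s_d⟩ := τ
  dsimp only at d' s' d_d s_d
  change CubicalStage.Compatible ⟨B, B'', d', s'⟩
  intro k i j a e hij
  have hle : i.castSucc < j.succ := Fin.castSucc_lt_succ_iff.2 hij
  -- Common form of the three cases where `k` differs from both face indices; the cases only shift
  -- the indices differently.
  have comm : ∀ i₁ j₁ : Fin (n + 1), i₁ ≤ j₁ → ∀ (l : Fin (n + 1)),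
      d' j₁.succ e ≫ d i₁ a ≫ s l = d' i₁.castSucc a ≫ d j₁ e ≫ s l := fun i₁ j₁ h l => by
    rw [← Category.assoc, d_d i₁ j₁ a e h, Category.assoc]
  rcases lt_trichotomy k i.castSucc with hk | rfl | hk
  · -- `k < i`
    obtain ⟨i, rfl⟩ : ∃ i' : Fin (n + 1), i'.succ = i :=
      Fin.exists_succ_eq.2 (by rintro rfl; exact absurd hk (by simp))
    obtain ⟨j, rfl⟩ : ∃ j' : Fin (n + 1), j'.succ = j :=
      Fin.exists_succ_eq.2 (by rintro rfl; exact absurd hij (by simp))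
    have hij' : i ≤ j := Fin.succ_le_succ_iff.1 hij
    obtain ⟨k, rfl⟩ : ∃ k' : Fin (n + 1), k'.castSucc.castSucc = k :=
      ⟨⟨k, by have : (k : ℕ) < (i.succ.castSucc : ℕ) := hk; simp at this; omega⟩, rfl⟩
    have hki : k ≤ i := by
      have : (k : ℕ) < (i.succ.castSucc : ℕ) := hk
      rw [Fin.le_def]; simp at this; omega
    rw [faces_gt _ _ _ (Fin.le_def.2 (by have := Fin.le_def.1 (hki.trans hij'); simp; omega)),
      ← Fin.succ_castSucc, faces_gt _ _ _ (Fin.castSucc_le_castSucc_iff.2 hki)]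
    simp only [Category.assoc]
    rw [s_d, s_d, faces_gt _ _ _ hki, faces_gt _ _ _ (hki.trans hij')]
    exact comm i j hij' k
  · rw [faces_self, faces_gt _ _ _ hij, Category.assoc, s_d, faces_self, Category.id_comp]
    exact Category.comp_id _
  · rcases lt_trichotomy k j.succ with hk' | rfl | hk'
    · -- `i < k < j`
      obtain ⟨k, rfl⟩ : ∃ k' : Fin (n + 1), k'.succ.castSucc = k := by
        refine ⟨⟨(k : ℕ) - 1, ?_⟩, ?_⟩
        · have h₁ : (k : ℕ) < (j.succ : ℕ) := hk'
          have h₂ : (i.castSucc : ℕ) < (k : ℕ) := hk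
          have := j.2
          simp at h₁ h₂; omega
        · have h₂ : (i.castSucc : ℕ) < (k : ℕ) := hk
          ext; simp at h₂ ⊢; omega
      have hik : i ≤ k.castSucc := by
        have h₂ : (i.castSucc : ℕ) < (k.succ.castSucc : ℕ) := hk
        rw [Fin.le_def]; simp at h₂ ⊢; omega
      have hkj : k.succ ≤ j := by
        have h₁ : (k.succ.castSucc : ℕ) < (j.succ : ℕ) := hk'
        rw [Fin.le_def]; simp at h₁ ⊢; omega
      obtain ⟨j, rfl⟩ : ∃ j' : Fin (n + 1), j'.succ = j :=
        Fin.exists_succ_eq.2 (by rintro rfl; exact absurd hkj (by simp))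
      have hkj' : k ≤ j := Fin.succ_le_succ_iff.1 hkj
      obtain ⟨i, rfl⟩ : ∃ i' : Fin (n + 1), i'.castSucc = i :=
        ⟨⟨i, by have := Fin.le_def.1 hik; simp at this; omega⟩, rfl⟩
      have hik' : i ≤ k := hik
      rw [faces_gt _ _ _ hkj, ← Fin.succ_castSucc, faces_lt _ _ _ hik]
      simp only [Category.assoc]
      rw [s_d, s_d, faces_lt _ _ _ hik', faces_gt _ _ _ hkj']
      exact comm i j (hik'.trans hkj') k
    · rw [faces_self, faces_lt _ _ _ hij, Category.assoc, s_d, faces_self, Category.id_comp]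
      exact (Category.comp_id _).symm
    · -- `j < k`
      obtain ⟨k, rfl⟩ : ∃ k' : Fin (n + 1), k'.succ.succ = k := by
        refine ⟨⟨(k : ℕ) - 2, ?_⟩, ?_⟩
        · have h₁ : (j.succ : ℕ) < (k : ℕ) := hk'
          have := k.2
          simp at h₁; omega
        · have h₁ : (j.succ : ℕ) < (k : ℕ) := hk'
          ext; simp at h₁ ⊢; omega
      have hjk : j ≤ k.castSucc := by
        have h₁ : (j.succ : ℕ) < (k.succ.succ : ℕ) := hk'
        rw [Fin.le_def]; simp at h₁ ⊢; omega
      obtain ⟨j, rfl⟩ : ∃ j' : Fin (n + 1), j'.castSucc = j :=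
        ⟨⟨j, by have := Fin.le_def.1 hjk; simp at this; omega⟩, rfl⟩
      obtain ⟨i, rfl⟩ : ∃ i' : Fin (n + 1), i'.castSucc = i :=
        ⟨⟨i, by have := Fin.le_def.1 (hij.trans hjk); simp at this; omega⟩, rfl⟩
      have hjk' : j ≤ k := hjk
      have hij' : i ≤ j := hij
      have hjks : j.succ ≤ k.succ := Fin.succ_le_succ_iff.2 hjk'
      have hiks : i.castSucc ≤ k.succ := (Fin.castSucc_lt_succ_iff.2 (hij'.trans hjk')).le
      rw [Fin.succ_castSucc, faces_lt _ _ _ hjks, faces_lt _ _ _ hiks]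
      simp only [Category.assoc]
      rw [s_d, s_d, faces_lt _ _ _ (hij'.trans hjk'), faces_lt _ _ _ hjk']
      exact comm i j hij' k

end Extension

/-- The new object is a `P`-cover `q` of the cubical kernel. The prescribed faces of each
pseudodegeneracy define a morphism from `σ.B` to that kernel, and it lifts along `q` because `σ.B`
is in `P`. The canonical morphism to the kernel is then `q` itself. -/
lemma exists_extension [HasFiniteLimits C] {P : ObjectProperty C} (hP : IsProjectiveClass P)
    (hσ : σ.Compatible) (hB : P σ.B) :
    ∃ τ : σ.Extension, P τ.B ∧ IsPEpi P (cubicalKernelLift σ.d τ.d τ.d_d) := by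
  obtain ⟨Q, q, hQ, hq⟩ := hP (cubicalKernel σ.d)
  choose s hs using fun k => hq _ hB (cubicalKernelLift σ.d (σ.faces k) (hσ k))
  let τ : σ.Extension :=
    { B := Q
      d := fun i a => q ≫ cubicalKernelπ σ.d i a
      s := s
      d_d := fun i j a e h => by
        rw [Category.assoc, Category.assoc, cubicalKernel_condition σ.d i j a e h]
      s_d := fun k j a => by
        have h := congrArg (· ≫ cubicalKernelπ σ.d j a) (hs k)
        simpa only [Category.assoc, cubicalKernelLift_π] using h }
  refine ⟨τ, hQ, ?_⟩
  have h : cubicalKernelLift σ.d τ.d τ.d_d = q :=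
    cubicalKernel_hom_ext σ.d fun i a => cubicalKernelLift_π _ _ _ i a
  rw [h]
  exact hq

lemma compatible_zero (σ : CubicalStage C 0) (h : ∀ a, σ.s 0 ≫ σ.d 0 a = 𝟙 _) :
    σ.Compatible := by
  intro k i j a e _
  obtain rfl : i = 0 := by ext; omega
  obtain rfl : j = 0 := by ext; omega
  refine Fin.cases ?_ (fun k => ?_) k
  · have h₁ := σ.faces_gt 0 0 le_rfl e
    rw [Fin.castSucc_zero] at h₁
    rw [h₁, Category.assoc, h, Category.comp_id, Fin.castSucc_zero, faces_self, Category.id_comp]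
  · obtain rfl : k = 0 := by ext; omega
    rw [faces_self, faces_lt _ _ _ le_rfl, Category.assoc, h, Category.comp_id, Category.id_comp]

end CubicalStage

variable [HasFiniteLimits C] {P : ObjectProperty C}

/-- Every object has a `P`-projective pseudocubical resolution if `P` is a projective class. -/
lemma nonempty_pseudocubicalResolution (hP : IsProjectiveClass P) (Y : C) :
    Nonempty (PseudocubicalResolution P Y) := by
  obtain ⟨X₀, ε, hX₀, hε⟩ := hP Y
  obtain ⟨X₁, q, hX₁, hq⟩ := hP (pullback ε ε)
  -- The first pseudodegeneracy is a lift of the diagonal of `X₀` over `Y`; both its faces are then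
  -- identities.
  obtain ⟨s, hs⟩ := hq X₀ hX₀ (pullback.lift (𝟙 X₀) (𝟙 X₀) rfl)
  have hs' : s ≫ q = pullback.lift (𝟙 X₀) (𝟙 X₀) rfl := hs
  let σ₀ : CubicalStage C 0 :=
    { A := X₀
      B := X₁
      d := fun _ a => bif a then q ≫ pullback.snd ε ε else q ≫ pullback.fst ε ε
      s := fun _ => s }
  have hσ₀ : ∀ a, σ₀.s 0 ≫ σ₀.d 0 a = 𝟙 _ := by
    intro a
    cases a
    · change s ≫ q ≫ pullback.fst ε ε = 𝟙 X₀
      rw [← Category.assoc, hs', pullback.lift_fst]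
    · change s ≫ q ≫ pullback.snd ε ε = 𝟙 X₀
      rw [← Category.assoc, hs', pullback.lift_snd]
  -- The recursion carries compatibility and membership in `P`, exactly the hypotheses needed to
  -- extend a stage again.
  choose next hmem hepi using fun (n : ℕ)
    (σ : { σ : CubicalStage C n // σ.Compatible ∧ P σ.B }) =>
      σ.1.exists_extension hP σ.2.1 σ.2.2
  let seq : ∀ n, { σ : CubicalStage C n // σ.Compatible ∧ P σ.B } := fun n =>
    Nat.rec ⟨σ₀, σ₀.compatible_zero hσ₀, hX₁⟩
      (fun n σ => ⟨(next n σ).stage, (next n σ).compatible, hmem n σ⟩) n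
  exact ⟨
    { X := fun n => (seq n).1.A
      d := fun n => (seq n).1.d
      s := fun n => (seq n).1.s
      d_d := fun n => (next n (seq n)).d_d
      s_d_lt := fun n i j a h =>
        ((next n (seq n)).s_d _ _ a).trans ((seq n).1.faces_lt i j h a)
      -- Only stages after the first arise from an extension, so degree 0 uses the diagonal lift
      -- directly.
      s_d_self := fun n i a => match n with
        | 0 => by
          obtain rfl : i = 0 := by ext; omega
          exact hσ₀ a
        | n + 1 => ((next n (seq n)).s_d i i a).trans ((seq n).1.faces_self i a)
      s_d_gt := fun n i j a h =>
        ((next n (seq n)).s_d _ _ a).trans ((seq n).1.faces_gt i j h a)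
      aug := ε
      aug_w := by
        change (q ≫ pullback.fst ε ε) ≫ ε = (q ≫ pullback.snd ε ε) ≫ ε
        rw [Category.assoc, Category.assoc, pullback.condition]
      mem := fun n => match n with
        | 0 => hX₀
        | n + 1 => (seq n).2.2
      exact :=
        { zero := hε
          one := by
            have h : ∀ w, pullback.lift (f := ε) (g := ε) (q ≫ pullback.fst ε ε)
                (q ≫ pullback.snd ε ε) w = q := fun w => by
              apply pullback.hom_ext
              · rw [pullback.lift_fst]
              · rw [pullback.lift_snd]
            exact (h _).symm ▸ hq
          succ := fun n => hepi n (seq n) } }⟩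

end Existence

/-! ### Presimplicial resolutions and their alternating-sum complexes in `ℤC` -/

/-- An augmented presimplicial object. The object `X 0` is the augmentation, and
`d n i : X_{n+1} ⟶ X_n`, `i ≤ n`, are the faces. -/
structure PresimplicialObject (C : Type u) [Category.{v} C] where
  X : ℕ → C
  d : ∀ n : ℕ, Fin (n + 1) → (X (n + 1) ⟶ X n)
  d_d : ∀ (n : ℕ) (i j : Fin (n + 1)), i ≤ j →
    d (n + 1) j.succ ≫ d n i = d (n + 1) i.castSucc ≫ d n j

namespace PresimplicialObject

section Basic

variable {C : Type u} [Category.{v} C] {D : Type u'} [Category.{v'} D]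

/-- The image of a presimplicial object under a functor. -/
def map (F : C ⥤ D) (X : PresimplicialObject C) : PresimplicialObject D where
  X n := F.obj (X.X n)
  d n i := F.map (X.d n i)
  d_d n i j h := by rw [← F.map_comp, ← F.map_comp, X.d_d n i j h]

end Basic

section Preadditive

variable {D : Type u} [Category.{v} D] [Preadditive D] (X : PresimplicialObject D)

/-- The alternating sum of the faces. -/
def objD (n : ℕ) : X.X (n + 1) ⟶ X.X n :=
  ∑ i : Fin (n + 1), (-1 : ℤ) ^ (i : ℕ) • X.d n i

/-- The terms with `j ≤ i` cancel against the others under `(i, j) ↦ (j, i + 1)`, which preserves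
the composite face and reverses the sign. -/
lemma objD_objD (n : ℕ) : X.objD (n + 1) ≫ X.objD n = 0 := by
  unfold objD
  simp only [Preadditive.comp_sum, Preadditive.sum_comp, ← Finset.sum_product']
  let P := Fin (n + 1) × Fin (n + 2)
  let S : Finset P := {ij : P | (ij.2 : ℕ) ≤ (ij.1 : ℕ)}
  rw [Finset.univ_product_univ, ← Finset.sum_add_sum_compl S, ← eq_neg_iff_add_eq_zero,
    ← Finset.sum_neg_distrib]
  let φ : ∀ ij : P, ij ∈ S → P := fun ij hij =>
    (Fin.castLT ij.2 (lt_of_le_of_lt (Finset.mem_filter.mp hij).right (Fin.is_lt ij.1)), ij.1.succ)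
  apply Finset.sum_bij φ
  · intro ij hij
    simp_rw [S, φ, Finset.compl_filter, Finset.mem_filter_univ, Fin.val_succ,
      Fin.val_castLT] at hij ⊢
    lia
  · rintro ⟨i, j⟩ hij ⟨i', j'⟩ hij' h
    rw [Prod.mk_inj]
    exact ⟨by simpa [φ] using! congr_arg Prod.snd h,
      by simpa [φ, Fin.castSucc_castLT] using! congr_arg Fin.castSucc (congr_arg Prod.fst h)⟩
  · rintro ⟨i', j'⟩ hij'
    simp_rw [S, Finset.compl_filter, Finset.mem_filter_univ, not_le] at hij'
    refine ⟨(j'.pred <| ?_, Fin.castSucc i'), ?_, ?_⟩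
    · rintro rfl
      simp only [Fin.val_zero, not_lt_zero] at hij'
    · simpa [S] using! Nat.le_sub_one_of_lt hij'
    · simp only [φ, Fin.castLT_castSucc, Fin.succ_pred]
  · rintro ⟨i, j⟩ hij
    have hj : (j : ℕ) ≤ i := by simpa [S] using! hij
    have hji : j.castLT (lt_of_le_of_lt hj i.is_lt) ≤ i := by
      rw [Fin.le_def]; simpa using hj
    have key := X.d_d n _ i hji
    rw [Fin.castSucc_castLT] at key
    dsimp only [φ]
    rw [Preadditive.zsmul_comp, Preadditive.comp_zsmul, Preadditive.zsmul_comp,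
      Preadditive.comp_zsmul, smul_smul, smul_smul, ← neg_smul, key]
    congr 1
    simp only [Fin.val_succ, Fin.val_castLT]
    ring

lemma comp_objD {T : D} (n : ℕ) (x : T ⟶ X.X (n + 1)) :
    x ≫ X.objD n = ∑ i : Fin (n + 1), (-1 : ℤ) ^ (i : ℕ) • (x ≫ X.d n i) := by
  rw [objD, Preadditive.comp_sum]
  simp only [Preadditive.comp_zsmul]

/-- The chain complex of a presimplicial object `X` over `X 0`. -/
def complex : ChainComplex D ℕ :=
  ChainComplex.of (fun n => X.X (n + 1)) (fun n => X.objD (n + 1)) (fun n => X.objD_objD (n + 1))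

lemma complex_d (n : ℕ) : X.complex.d (n + 1) n = X.objD (n + 1) :=
  ChainComplex.of_d (fun n => X.X (n + 1)) (fun n => X.objD (n + 1)) n

end Preadditive

section Contraction

variable {C : Type u} [Category.{v} C]

/-- A presimplicial object `X` is a `P`-projective resolution of `X 0`: its objects are in `P`, and
the canonical morphisms to the simplicial kernels are `P`-epimorphisms. -/
structure IsProjectiveResolution (P : ObjectProperty C) (X : PresimplicialObject C) : Prop where
  mem : ∀ n, P (X.X (n + 1))
  zero : ∀ Q, P Q → ∀ x : Q ⟶ X.X 0, ∃ z : Q ⟶ X.X 1, z ≫ X.d 0 0 = x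
  succ : ∀ Q, P Q → ∀ (n : ℕ) (x : Fin (n + 2) → (Q ⟶ X.X (n + 1))),
    (∀ i j : Fin (n + 1), i ≤ j → x j.succ ≫ X.d n i = x i.castSucc ≫ X.d n j) →
    ∃ z : Q ⟶ X.X (n + 2), ∀ i, z ≫ X.d (n + 1) i = x i

variable {X : PresimplicialObject C} {Q : C} {P : ObjectProperty C}

variable (X Q) in
/-- Two consecutive components of a contraction of the presimplicial set `Hom(Q, X)`. -/
def ContractionPair (n : ℕ) : Type v :=
  { p : ((Q ⟶ X.X n) → (Q ⟶ X.X (n + 1))) × ((Q ⟶ X.X (n + 1)) → (Q ⟶ X.X (n + 2))) //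
    (∀ x, p.1 x ≫ X.d n 0 = x) ∧ (∀ x, p.2 x ≫ X.d (n + 1) 0 = x) ∧
    ∀ x i, p.2 x ≫ X.d (n + 1) i.succ = p.1 (x ≫ X.d n i) }

variable (X) in
/-- The faces prescribed for the value at `x` of the next component of a contraction. -/
def contractionFaces (n : ℕ) (h : (Q ⟶ X.X n) → (Q ⟶ X.X (n + 1))) (x : Q ⟶ X.X (n + 1))
    (i : Fin (n + 2)) : Q ⟶ X.X (n + 1) :=
  Fin.cases x (fun i => h (x ≫ X.d n i)) i

lemma exists_contractionPair_zero (hX : X.IsProjectiveResolution P) (hQ : P Q) :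
    Nonempty (X.ContractionPair Q 0) := by
  choose h₀ hh₀ using hX.zero Q hQ
  have e₁ : ∀ x : Q ⟶ X.X 1, ∃ z : Q ⟶ X.X 2,
      ∀ i, z ≫ X.d 1 i = X.contractionFaces 0 h₀ x i := fun x =>
    hX.succ Q hQ 0 _ (by
      intro i j _
      obtain rfl : i = 0 := by ext; omega
      obtain rfl : j = 0 := by ext; omega
      exact hh₀ _)
  choose h₁ hh₁ using e₁
  exact ⟨⟨(h₀, h₁), hh₀, fun x => hh₁ x 0, fun x i => hh₁ x i.succ⟩⟩

/-- As in the cubical case, with a single end per direction: the new value at `x` is a filler whose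
first face is `x`. -/
lemma ContractionPair.exists_succ (hX : X.IsProjectiveResolution P) (hQ : P Q) {n : ℕ}
    (p : X.ContractionPair Q n) : ∃ q : X.ContractionPair Q (n + 1), q.1.1 = p.1.2 := by
  have e : ∀ x : Q ⟶ X.X (n + 2), ∃ z : Q ⟶ X.X (n + 3),
      ∀ i, z ≫ X.d (n + 2) i = X.contractionFaces (n + 1) p.1.2 x i := fun x =>
    hX.succ Q hQ (n + 1) _ (by
      intro i j hij
      change p.1.2 _ ≫ _ = _
      revert hij
      refine Fin.cases ?_ (fun i => ?_) i
      · intro _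
        exact p.2.2.1 _
      · refine Fin.cases (fun h => ?_) (fun j hij => ?_) j
        · exact absurd h (by simp)
        · change _ = p.1.2 (x ≫ X.d (n + 1) i.castSucc) ≫ _
          rw [p.2.2.2, p.2.2.2, Category.assoc, Category.assoc,
            X.d_d n i j (Fin.succ_le_succ_iff.1 hij)])
  choose h hh using e
  exact ⟨⟨(p.1.2, h), p.2.2.1, fun x => hh x 0, fun x i => hh x i.succ⟩, rfl⟩

/-- These maps act as an extra degeneracy on the presimplicial set. As the augmentation is the
object of index 0, the component `h 0` is itself the section of `Hom(Q, X 1) → Hom(Q, X 0)`, so no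
collapse is needed. -/
lemma IsProjectiveResolution.exists_contraction (hX : X.IsProjectiveResolution P) (hQ : P Q) :
    ∃ h : ∀ n, (Q ⟶ X.X n) → (Q ⟶ X.X (n + 1)),
      (∀ n x, h n x ≫ X.d n 0 = x) ∧
      ∀ n i x, h (n + 1) x ≫ X.d (n + 1) i.succ = h n (x ≫ X.d n i) := by
  obtain ⟨p₀⟩ := exists_contractionPair_zero hX hQ
  choose next hnext using fun (n : ℕ) (p : X.ContractionPair Q n) => p.exists_succ hX hQ
  let seq : ∀ n, X.ContractionPair Q n := fun n => Nat.rec p₀ next n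
  refine ⟨fun n => (seq n).1.1, fun n x => (seq n).2.1 x, fun n i x => ?_⟩
  have h : (seq (n + 1)).1.1 = (seq n).1.2 := hnext n (seq n)
  exact (congrFun h x ▸ (seq n).2.2.2 x i :)

lemma IsProjectiveResolution.free_surjective (hX : X.IsProjectiveResolution P) (hQ : P Q)
    (y : (Free.embedding ℤ C).obj Q ⟶ (X.map (Free.embedding ℤ C)).X 0) :
    ∃ z : (Free.embedding ℤ C).obj Q ⟶ (X.map (Free.embedding ℤ C)).X 1,
      z ≫ (X.map (Free.embedding ℤ C)).objD 0 = y := by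
  obtain ⟨h, h0, -⟩ := hX.exists_contraction hQ
  let z : (Free.embedding ℤ C).obj Q ⟶ (X.map (Free.embedding ℤ C)).X 1 := freeHomMap (h 0) y
  refine ⟨z, ?_⟩
  rw [comp_objD, Fin.sum_univ_succ, Fin.sum_univ_zero, add_zero, Fin.val_zero, pow_zero, one_smul]
  exact freeHomMap_comp_eq_self (h 0) _ (h0 0) y

/-- The boundary of `h y` is `y - h(∂y)`, without any normalization. The case `n = 0` is exactness
next to the augmentation. -/
lemma IsProjectiveResolution.free_exact (hX : X.IsProjectiveResolution P) (hQ : P Q) (n : ℕ)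
    (y : (Free.embedding ℤ C).obj Q ⟶ (X.map (Free.embedding ℤ C)).X (n + 1))
    (hy : y ≫ (X.map (Free.embedding ℤ C)).objD n = 0) :
    ∃ z : (Free.embedding ℤ C).obj Q ⟶ (X.map (Free.embedding ℤ C)).X (n + 2),
      z ≫ (X.map (Free.embedding ℤ C)).objD (n + 1) = y := by
  obtain ⟨h, h0, h1⟩ := hX.exists_contraction hQ
  let z : (Free.embedding ℤ C).obj Q ⟶ (X.map (Free.embedding ℤ C)).X (n + 2) :=
    freeHomMap (h (n + 1)) y
  let L : ((Free.embedding ℤ C).obj Q ⟶ (X.map (Free.embedding ℤ C)).X n) →+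
    ((Free.embedding ℤ C).obj Q ⟶ (X.map (Free.embedding ℤ C)).X (n + 1)) := freeHomMap (h n)
  have key : ∀ i : Fin (n + 1),
      z ≫ (X.map (Free.embedding ℤ C)).d (n + 1) i.succ =
        L (y ≫ (X.map (Free.embedding ℤ C)).d n i) := fun i =>
    freeHomMap_comp _ _ _ _ (h1 n i) y
  have key₀ : z ≫ (X.map (Free.embedding ℤ C)).d (n + 1) 0 = y :=
    freeHomMap_comp_eq_self _ _ (h0 (n + 1)) y
  refine ⟨z, ?_⟩
  rw [comp_objD] at hy
  rw [comp_objD, Fin.sum_univ_succ, Fin.val_zero, pow_zero, one_smul, key₀]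
  have hL : ∑ i : Fin (n + 1), (-1 : ℤ) ^ (i.succ : ℕ) •
      (z ≫ (X.map (Free.embedding ℤ C)).d (n + 1) i.succ) =
      - L (∑ i : Fin (n + 1), (-1 : ℤ) ^ (i : ℕ) •
        (y ≫ (X.map (Free.embedding ℤ C)).d n i)) := by
    rw [map_sum, ← Finset.sum_neg_distrib]
    refine Finset.sum_congr rfl fun i _ => ?_
    rw [key, map_zsmul, Fin.val_succ, pow_succ, mul_neg_one, neg_smul]
  rw [hL, hy, map_zero, neg_zero, add_zero]

lemma IsProjectiveResolution.isResolution (hX : X.IsProjectiveResolution P) :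
    IsResolution (inFree P) (X.map (Free.embedding ℤ C)).complex
      ((X.map (Free.embedding ℤ C)).objD 0) where
  d_aug := by
    rw [complex_d]
    exact (X.map (Free.embedding ℤ C)).objD_objD 0
  surjective := by
    rintro _ ⟨Q, hQ⟩ y
    exact hX.free_surjective hQ y
  exact_zero := by
    rintro _ ⟨Q, hQ⟩ y
    rw [complex_d]
    constructor
    · exact hX.free_exact hQ 0 y
    · rintro ⟨x, rfl⟩
      exact (Category.assoc _ _ _).trans
        ((congrArg (x ≫ ·) ((X.map (Free.embedding ℤ C)).objD_objD 0)).trans comp_zero)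
  exact_succ := by
    rintro n _ ⟨Q, hQ⟩ y
    rw [complex_d, complex_d]
    constructor
    · exact hX.free_exact hQ (n + 1) y
    · rintro ⟨x, rfl⟩
      exact (Category.assoc _ _ _).trans
        ((congrArg (x ≫ ·) ((X.map (Free.embedding ℤ C)).objD_objD (n + 1))).trans comp_zero)
  mem n := ⟨_, hX.mem n⟩

end Contraction

/-! ### Existence of `P`-resolutions in `ℤC` -/

section Existence

variable {C : Type u} [Category.{v} C] [HasFiniteLimits C] {P : ObjectProperty C}

/-- A compatible simplicial family, doubled to be constant in `Bool`, is a compatible cubical one.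
Covering the cubical kernel and keeping only the `false` projections thus gives the existence of
fillers; uniqueness fails but is not needed. -/
lemma exists_weakSimplicialKernel (hP : IsProjectiveClass P) {A B : C} {n : ℕ}
    (f : Fin (n + 1) → (B ⟶ A)) :
    ∃ (K : C) (d : Fin (n + 2) → (K ⟶ B)), P K ∧
      (∀ i j : Fin (n + 1), i ≤ j → d j.succ ≫ f i = d i.castSucc ≫ f j) ∧
      ∀ Q, P Q → ∀ x : Fin (n + 2) → (Q ⟶ B),
        (∀ i j : Fin (n + 1), i ≤ j → x j.succ ≫ f i = x i.castSucc ≫ f j) →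
        ∃ z : Q ⟶ K, ∀ i, z ≫ d i = x i := by
  obtain ⟨K, q, hK, hq⟩ := hP (cubicalKernel fun i (_ : Bool) => f i)
  refine ⟨K, fun i => q ≫ cubicalKernelπ _ i false, hK, fun i j h => ?_, fun Q hQ x hx => ?_⟩
  · rw [Category.assoc, Category.assoc]
    exact congrArg (q ≫ ·) (cubicalKernel_condition (fun i (_ : Bool) => f i) i j false false h)
  · obtain ⟨z, hz⟩ := hq Q hQ (cubicalKernelLift (fun i (_ : Bool) => f i) (fun i _ => x i)
      fun i j _ _ h => hx i j h)
    refine ⟨z, fun i => ?_⟩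
    have h := congrArg (· ≫ cubicalKernelπ (fun i (_ : Bool) => f i) i false) hz
    simpa only [Category.assoc, cubicalKernelLift_π] using h

/-- Two consecutive objects of a presimplicial object with the faces between them. -/
structure Stage (C : Type u) [Category.{v} C] (n : ℕ) where
  A : C
  B : C
  d : Fin (n + 1) → (B ⟶ A)

lemma exists_isProjectiveResolution (hP : IsProjectiveClass P) (Y : C) :
    ∃ X : PresimplicialObject C, X.X 0 = Y ∧ X.IsProjectiveResolution P := by
  obtain ⟨X₀, ε, hX₀, hε⟩ := hP Y
  choose K d hK hd hl using fun (n : ℕ) (σ : Stage C n) => exists_weakSimplicialKernel hP σ.d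
  let seq : ∀ n, Stage C n := fun n =>
    Nat.rec ⟨Y, X₀, fun _ => ε⟩ (fun n σ => ⟨σ.B, K n σ, d n σ⟩) n
  exact ⟨
    { X := fun n => (seq n).A
      d := fun n => (seq n).d
      d_d := fun n => hd n (seq n) }, rfl,
    { mem := fun n => match n with
        | 0 => hX₀
        | n + 1 => hK n (seq n)
      zero := fun Q hQ x => hε Q hQ x
      succ := fun Q hQ n => hl n (seq n) Q hQ }⟩

/-- Every object of `C` possesses a `P`-resolution in `ℤC` if `P` is a projective class. -/
lemma possessesResolution_embedding (hP : IsProjectiveClass P) (Y : C) :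
    possessesResolution (inFree P) ((Free.embedding ℤ C).obj Y) := by
  obtain ⟨X, rfl, hX⟩ := exists_isProjectiveResolution hP Y
  exact ⟨⟨_, _, hX.isResolution⟩⟩

end Existence

end PresimplicialObject

/-! ### Extending functors to the idempotent completion -/

section KaroubiExtension

open Idempotents

variable {D : Type u} [Category.{v} D] {B : Type u'} [Category.{v'} B] [IsIdempotentComplete B]

/-- The extension of a functor to the idempotent completion restricts to the given functor. -/
def functorExtensionCompIso (F : D ⥤ B) :
    toKaroubi D ⋙ (functorExtension D B).obj F ≅ F :=
  Functor.isoWhiskerRight ((functorExtension₂CompWhiskeringLeftToKaroubiIso D B).app F)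
      (toKaroubiEquivalence B).inverse ≪≫
    Functor.isoWhiskerLeft F (toKaroubiEquivalence B).unitIso.symm

/-- Naturality in the functor comes from pasting the square for the extension into `Karoubi B` with
the square for the unit of the equivalence between `B` and `Karoubi B`. -/
lemma functorExtensionCompIso_naturality {F G : D ⥤ B} (α : F ⟶ G) (X : D) :
    ((functorExtension D B).map α).app ((toKaroubi D).obj X) ≫
        (functorExtensionCompIso G).hom.app X =
      (functorExtensionCompIso F).hom.app X ≫ α.app X := by
  let J := (toKaroubiEquivalence B).inverse
  let θ := (functorExtension₂CompWhiskeringLeftToKaroubiIso D B).hom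
  let η := (toKaroubiEquivalence B).unitIso.inv
  have h₁ : ((functorExtension₂ D B).map α).app ((toKaroubi D).obj X) ≫ (θ.app G).app X =
      (θ.app F).app X ≫ (toKaroubi B).map (α.app X) :=
    NatTrans.congr_app (θ.naturality α) X
  have h₂ : J.map ((toKaroubi B).map (α.app X)) ≫ η.app (G.obj X) = η.app (F.obj X) ≫ α.app X :=
    η.naturality (α.app X)
  change J.map _ ≫ J.map ((θ.app G).app X) ≫ η.app (G.obj X) =
    (J.map ((θ.app F).app X) ≫ η.app (F.obj X)) ≫ α.app X
  have h₃ : J.map (((functorExtension₂ D B).map α).app ((toKaroubi D).obj X)) ≫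
      J.map ((θ.app G).app X) = J.map ((θ.app F).app X) ≫ J.map ((toKaroubi B).map (α.app X)) :=
    (J.map_comp _ _).symm.trans ((congrArg J.map h₁).trans (J.map_comp _ _))
  exact (Category.assoc _ _ _).symm.trans ((congrArg (· ≫ η.app (G.obj X)) h₃).trans
    ((Category.assoc _ _ _).trans ((congrArg (J.map ((θ.app F).app X) ≫ ·) h₂).trans
      (Category.assoc _ _ _).symm)))

/-- Sums of morphisms in the idempotent completion are computed on underlying morphisms, and the
inverse of the additive equivalence `toKaroubi B` is additive. -/
instance [Preadditive D] [Preadditive B] (F : D ⥤ B) [F.Additive] :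
    ((functorExtension D B).obj F).Additive := by
  have : ((functorExtension₂ D B).obj F).Additive :=
    ⟨by
      intro X Y f g
      ext
      exact F.map_add⟩
  have : (toKaroubiEquivalence B).inverse.Additive := inferInstance
  exact inferInstanceAs (((functorExtension₂ D B).obj F) ⋙
    (toKaroubiEquivalence B).inverse).Additive

end KaroubiExtension

/-! ### Independence of the chosen resolution -/

section ResolutionComparison

variable {A : Type u} [Category.{v} A] [Preadditive A] {P : ObjectProperty A}
  {D : Type u'} [Category.{v'} D] [Abelian D]

lemma homologyMapOf_comp (F : A ⥤ D) [F.Additive] {K L M : ChainComplex A ℕ} (φ : K ⟶ L)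
    (ψ : L ⟶ M) (n : ℕ) :
    homologyMapOf F (φ ≫ ψ) n = homologyMapOf F φ n ≫ homologyMapOf F ψ n := by
  unfold homologyMapOf
  rw [CategoryTheory.Functor.map_comp, HomologicalComplex.homologyMap_comp]

lemma homologyMapOf_id (F : A ⥤ D) [F.Additive] (K : ChainComplex A ℕ) (n : ℕ) :
    homologyMapOf F (𝟙 K) n = 𝟙 _ := by
  unfold homologyMapOf
  rw [CategoryTheory.Functor.map_id, HomologicalComplex.homologyMap_id]

namespace Resolution

/-- The comparison isomorphism between the homology computed by two resolutions. -/
def homologyIso (F : A ⥤ D) [F.Additive] {Y : A} (R S : Resolution P Y) (n : ℕ) :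
    ((F.mapHomologicalComplex _).obj R.complex).homology n ≅
      ((F.mapHomologicalComplex _).obj S.complex).homology n where
  hom := homologyMapOf F (R.lift S (𝟙 Y)) n
  inv := homologyMapOf F (S.lift R (𝟙 Y)) n
  hom_inv_id := by
    rw [← homologyMapOf_comp, ← homologyMapOf_id]
    refine homologyMapOf_eq F R R _ _ ?_ n
    rw [HomologicalComplex.comp_f, Category.assoc, lift_aug, ← Category.assoc, lift_aug,
      Category.comp_id, Category.comp_id, HomologicalComplex.id_f, Category.id_comp]
  inv_hom_id := by
    rw [← homologyMapOf_comp, ← homologyMapOf_id]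
    refine homologyMapOf_eq F S S _ _ ?_ n
    rw [HomologicalComplex.comp_f, Category.assoc, lift_aug, ← Category.assoc, lift_aug,
      Category.comp_id, Category.comp_id, HomologicalComplex.id_f, Category.id_comp]

/-- Both composites come from chain maps `R ⟶ S'` over `f`, and such maps are homotopic. The lifts
`φ` and `ψ` are arbitrary, since one will be a normalized precubical morphism. -/
lemma homologyIso_hom_naturality (F : A ⥤ D) [F.Additive] {Y Z : A} (f : Y ⟶ Z)
    {R S : Resolution P Y} {R' S' : Resolution P Z} (φ : R.complex ⟶ R'.complex)
    (hφ : φ.f 0 ≫ R'.aug = R.aug ≫ f) (ψ : S.complex ⟶ S'.complex)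
    (hψ : ψ.f 0 ≫ S'.aug = S.aug ≫ f) (n : ℕ) :
    homologyMapOf F φ n ≫ (homologyIso F R' S' n).hom =
      (homologyIso F R S n).hom ≫ homologyMapOf F ψ n := by
  change homologyMapOf F φ n ≫ homologyMapOf F _ n = homologyMapOf F _ n ≫ homologyMapOf F ψ n
  rw [← homologyMapOf_comp, ← homologyMapOf_comp]
  refine homologyMapOf_eq F R S' _ _ ?_ n
  rw [HomologicalComplex.comp_f, HomologicalComplex.comp_f, Category.assoc, Category.assoc,
    lift_aug, hψ, ← Category.assoc, hφ, ← Category.assoc, lift_aug, Category.comp_id,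
    Category.comp_id]

lemma homologyIso_hom_natTrans {F G : A ⥤ D} [F.Additive] [G.Additive] (α : F ⟶ G) {Y : A}
    (R S : Resolution P Y) (n : ℕ) :
    HomologicalComplex.homologyMap ((NatTrans.mapHomologicalComplex α _).app R.complex) n ≫
        (homologyIso G R S n).hom =
      (homologyIso F R S n).hom ≫
        HomologicalComplex.homologyMap ((NatTrans.mapHomologicalComplex α _).app S.complex) n := by
  change _ ≫ HomologicalComplex.homologyMap _ n = HomologicalComplex.homologyMap _ n ≫ _
  rw [← HomologicalComplex.homologyMap_comp, ← HomologicalComplex.homologyMap_comp,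
    NatTrans.naturality]

end Resolution

end ResolutionComparison

lemma normalizedMap_f_aug {D : Type u} [Category.{v} D] [Preadditive D] [IsIdempotentComplete D]
    {X X' : PseudocubicalObject D} (φ : PseudocubicalObject.PreHom X X') {Y Y' : D} {ε : X.X 0 ⟶ Y}
    {ε' : X'.X 0 ⟶ Y'} {f : Y ⟶ Y'} (h : φ.f 0 ≫ ε' = ε ≫ f) :
    (PseudocubicalObject.normalizedMap φ).f 0 ≫ normalizedAug X' ε' = normalizedAug X ε ≫ f := by
  change _ ≫ X'.normalizedι 0 ≫ ε' = (X.normalizedι 0 ≫ ε) ≫ f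
  rw [← Category.assoc, PseudocubicalObject.normalizedMap_f_ι, Category.assoc, Category.assoc, h]

/-- Pasting of three squares for the zigzag that defines `comparisonIso`, whose first isomorphism is
traversed backwards. -/
lemma naturality_of_squares {B : Type*} [Category* B] {M₀ M₁ M₂ M₃ M₀' M₁' M₂' M₃' : B} (a : M₁ ≅ M₀) (b : M₁ ≅ M₂)
    (c : M₂ ≅ M₃) (a' : M₁' ≅ M₀') (b' : M₁' ≅ M₂') (c' : M₂' ≅ M₃') (m₀ : M₀ ⟶ M₀')
    (m₁ : M₁ ⟶ M₁') (m₂ : M₂ ⟶ M₂') (m₃ : M₃ ⟶ M₃') (ha : m₁ ≫ a'.hom = a.hom ≫ m₀)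
    (hb : m₁ ≫ b'.hom = b.hom ≫ m₂) (hc : m₂ ≫ c'.hom = c.hom ≫ m₃) :
    m₀ ≫ (a'.symm ≪≫ b' ≪≫ c').hom = (a.symm ≪≫ b ≪≫ c).hom ≫ m₃ := by
  rw [← cancel_epi a.hom, ← Category.assoc, ← ha]
  simp only [Iso.trans_hom, Iso.symm_hom, Category.assoc, Iso.hom_inv_id_assoc]
  rw [← hc, ← Category.assoc, hb, Category.assoc]

/-! ### Comparison of cubical and relative derived functors -/

section Comparison

open Idempotents PseudocubicalObject

variable {C : Type u} [Category.{v} C] {B : Type u'} [Category.{v'} B] [Abelian B]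

/-- The additive extension of `F : C ⥤ B` to the idempotent completion of `ℤC`. -/
def karoubiExtension (F : C ⥤ B) : Karoubi (Free ℤ C) ⥤ B :=
  (functorExtension (Free ℤ C) B).obj (additiveExtensionObj F)

instance (F : C ⥤ B) : (karoubiExtension F).Additive :=
  inferInstanceAs ((functorExtension (Free ℤ C) B).obj (additiveExtensionObj F)).Additive

/-- The extension of a natural transformation to the idempotent completion of `ℤC`. -/
def karoubiExtensionMap {F G : C ⥤ B} (α : F ⟶ G) : karoubiExtension F ⟶ karoubiExtension G :=
  (functorExtension (Free ℤ C) B).map (additiveExtension.map α).hom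

/-- The restriction of `karoubiExtension F` to `ℤC` is the additive extension of `F`. -/
def toKaroubiCompKaroubiExtension (F : C ⥤ B) :
    toKaroubi (Free ℤ C) ⋙ karoubiExtension F ≅ additiveExtensionObj F :=
  functorExtensionCompIso (additiveExtensionObj F)

/-- The restriction of `karoubiExtension F` to `C` is `F`. -/
def toKaroubiFreeCompKaroubiExtension (F : C ⥤ B) :
    toKaroubiFree C ⋙ karoubiExtension F ≅ F :=
  NatIso.ofComponents
    (fun Y => (toKaroubiCompKaroubiExtension F).app ((Free.embedding ℤ C).obj Y)) (fun f =>
      ((toKaroubiCompKaroubiExtension F).hom.naturality ((Free.embedding ℤ C).map f)).trans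
        (congrArg _ (additiveExtensionObj_map_embedding F f)))

lemma toKaroubiFreeCompKaroubiExtension_naturality {F G : C ⥤ B} (α : F ⟶ G) (Y : C) :
    (karoubiExtensionMap α).app ((toKaroubiFree C).obj Y) ≫
        (toKaroubiFreeCompKaroubiExtension G).hom.app Y =
      (toKaroubiFreeCompKaroubiExtension F).hom.app Y ≫ α.app Y :=
  functorExtensionCompIso_naturality (additiveExtension.map α).hom ((Free.embedding ℤ C).obj Y)

/-- The precubical morphism `F̃(X) ⟶ F(X)`, where `F̃` is the extension of `F` to the idempotent
completion of `ℤC`. -/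
def extensionPreHom (F : C ⥤ B) (X : PseudocubicalObject C) :
    PreHom ((X.map (toKaroubiFree C)).map (karoubiExtension F)) (X.map F) :=
  PreHom.ofNatTrans (toKaroubiFreeCompKaroubiExtension F).hom X

/-- The inverse natural transformation also gives a precubical morphism, and normalization is
functorial in these. -/
instance (F : C ⥤ B) (X : PseudocubicalObject C) : IsIso (normalizedMap (extensionPreHom F X)) := by
  let ψ : PreHom (X.map F) ((X.map (toKaroubiFree C)).map (karoubiExtension F)) :=
    PreHom.ofNatTrans (toKaroubiFreeCompKaroubiExtension F).inv X
  refine ⟨normalizedMap ψ, ?_, ?_⟩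
  · rw [← normalizedMap_comp, ← normalizedMap_id]
    congr 1
    ext k
    exact (toKaroubiFreeCompKaroubiExtension F).hom_inv_id_app _
  · rw [← normalizedMap_comp, ← normalizedMap_id]
    congr 1
    ext k
    exact (toKaroubiFreeCompKaroubiExtension F).inv_hom_id_app _

/-- The isomorphism `F̃(N(X)) ⟶ N(F(X))`, where `F̃` is the extension of `F` to the idempotent
completion of `ℤC`. -/
def normalizedExtension (F : C ⥤ B) (X : PseudocubicalObject C) :
    ((karoubiExtension F).mapHomologicalComplex _).obj (X.map (toKaroubiFree C)).normalized ⟶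
      (X.map F).normalized :=
  (X.map (toKaroubiFree C)).normalizedComparison (karoubiExtension F) ≫
    normalizedMap (extensionPreHom F X)

instance (F : C ⥤ B) (X : PseudocubicalObject C) : IsIso (normalizedExtension F X) := by
  unfold normalizedExtension
  infer_instance

/-- The isomorphism `H_n(F̃(N(X))) ≅ H_n(N(F(X)))`. -/
def normalizedExtensionHomologyIso (F : C ⥤ B) (X : PseudocubicalObject C) (n : ℕ) :
    (((karoubiExtension F).mapHomologicalComplex _).obj
      (X.map (toKaroubiFree C)).normalized).homology n ≅ (X.map F).normalized.homology n :=
  asIso (HomologicalComplex.homologyMap (normalizedExtension F X) n)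

lemma normalizedExtension_naturality (F : C ⥤ B) {X Y : PseudocubicalObject C} (φ : PreHom X Y) :
    ((karoubiExtension F).mapHomologicalComplex _).map
        (normalizedMap (φ.map (toKaroubiFree C))) ≫ normalizedExtension F Y =
      normalizedExtension F X ≫ normalizedMap (φ.map F) := by
  unfold normalizedExtension
  rw [← Category.assoc, normalizedComparison_naturality, Category.assoc, Category.assoc,
    ← normalizedMap_comp, ← normalizedMap_comp]
  congr 2
  ext k
  exact (toKaroubiFreeCompKaroubiExtension F).hom.naturality (φ.f k)

lemma normalizedExtensionHomologyIso_hom_naturality (F : C ⥤ B) {X Y : PseudocubicalObject C}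
    (φ : PreHom X Y) (n : ℕ) :
    homologyMapOf (karoubiExtension F) (normalizedMap (φ.map (toKaroubiFree C))) n ≫
        (normalizedExtensionHomologyIso F Y n).hom =
      (normalizedExtensionHomologyIso F X n).hom ≫ homologyNormalizedMap F φ n := by
  unfold homologyMapOf homologyNormalizedMap normalizedExtensionHomologyIso
  rw [asIso_hom, asIso_hom, ← HomologicalComplex.homologyMap_comp,
    ← HomologicalComplex.homologyMap_comp, normalizedExtension_naturality]

lemma normalizedExtension_natTrans {F G : C ⥤ B} (α : F ⟶ G) (X : PseudocubicalObject C) :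
    (NatTrans.mapHomologicalComplex (karoubiExtensionMap α) _).app
        (X.map (toKaroubiFree C)).normalized ≫ normalizedExtension G X =
      normalizedExtension F X ≫ normalizedMap (PreHom.ofNatTrans α X) := by
  unfold normalizedExtension
  rw [← Category.assoc, normalizedComparison_natTrans, Category.assoc, Category.assoc,
    ← normalizedMap_comp, ← normalizedMap_comp]
  congr 2
  ext k
  exact toKaroubiFreeCompKaroubiExtension_naturality α (X.X k)

lemma normalizedExtensionHomologyIso_hom_natTrans {F G : C ⥤ B} (α : F ⟶ G)
    (X : PseudocubicalObject C) (n : ℕ) :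
    HomologicalComplex.homologyMap ((NatTrans.mapHomologicalComplex (karoubiExtensionMap α) _).app
        (X.map (toKaroubiFree C)).normalized) n ≫ (normalizedExtensionHomologyIso G X n).hom =
      (normalizedExtensionHomologyIso F X n).hom ≫
        HomologicalComplex.homologyMap (normalizedMap (PreHom.ofNatTrans α X)) n := by
  unfold normalizedExtensionHomologyIso
  rw [asIso_hom, asIso_hom, ← HomologicalComplex.homologyMap_comp,
    ← HomologicalComplex.homologyMap_comp, normalizedExtension_natTrans]

/-- The isomorphism `F̃(K) ⟶ F_ad(K)` for a complex `K` in `ℤC`, where `F̃` is the extension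
of `F` to the idempotent completion of `ℤC`. -/
def complexExtension (F : C ⥤ B) (K : ChainComplex (Free ℤ C) ℕ) :
    ((karoubiExtension F).mapHomologicalComplex _).obj
        (((toKaroubi (Free ℤ C)).mapHomologicalComplex _).obj K) ⟶
      ((additiveExtensionObj F).mapHomologicalComplex _).obj K :=
  (NatTrans.mapHomologicalComplex (toKaroubiCompKaroubiExtension F).hom _).app K

instance (F : C ⥤ B) (K : ChainComplex (Free ℤ C) ℕ) : IsIso (complexExtension F K) := by
  have : ∀ n, IsIso ((complexExtension F K).f n) := fun n =>
    inferInstanceAs (IsIso ((toKaroubiCompKaroubiExtension F).hom.app (K.X n)))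
  exact HomologicalComplex.Hom.isIso_of_components _

/-- The isomorphism `H_n(F̃(K)) ≅ H_n(F_ad(K))`. -/
def complexExtensionHomologyIso (F : C ⥤ B) (K : ChainComplex (Free ℤ C) ℕ) (n : ℕ) :
    (((karoubiExtension F).mapHomologicalComplex _).obj
        (((toKaroubi (Free ℤ C)).mapHomologicalComplex _).obj K)).homology n ≅
      (((additiveExtensionObj F).mapHomologicalComplex _).obj K).homology n :=
  asIso (HomologicalComplex.homologyMap (complexExtension F K) n)

lemma complexExtension_naturality (F : C ⥤ B) {K L : ChainComplex (Free ℤ C) ℕ} (φ : K ⟶ L) :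
    ((karoubiExtension F).mapHomologicalComplex _).map
        (((toKaroubi (Free ℤ C)).mapHomologicalComplex _).map φ) ≫ complexExtension F L =
      complexExtension F K ≫ ((additiveExtensionObj F).mapHomologicalComplex _).map φ := by
  ext n
  exact (toKaroubiCompKaroubiExtension F).hom.naturality (φ.f n)

lemma complexExtensionHomologyIso_hom_naturality (F : C ⥤ B) {K L : ChainComplex (Free ℤ C) ℕ}
    (φ : K ⟶ L) (n : ℕ) :
    homologyMapOf (karoubiExtension F) (((toKaroubi (Free ℤ C)).mapHomologicalComplex _).map φ) n ≫
        (complexExtensionHomologyIso F L n).hom =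
      (complexExtensionHomologyIso F K n).hom ≫ homologyMapOf (additiveExtensionObj F) φ n := by
  unfold homologyMapOf complexExtensionHomologyIso
  rw [asIso_hom, asIso_hom, ← HomologicalComplex.homologyMap_comp,
    ← HomologicalComplex.homologyMap_comp, complexExtension_naturality]

lemma complexExtension_natTrans {F G : C ⥤ B} (α : F ⟶ G) (K : ChainComplex (Free ℤ C) ℕ) :
    (NatTrans.mapHomologicalComplex (karoubiExtensionMap α) _).app
        (((toKaroubi (Free ℤ C)).mapHomologicalComplex _).obj K) ≫ complexExtension G K =
      complexExtension F K ≫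
        (NatTrans.mapHomologicalComplex (additiveExtension.map α).hom _).app K := by
  ext n
  exact functorExtensionCompIso_naturality (additiveExtension.map α).hom (K.X n)

lemma complexExtensionHomologyIso_hom_natTrans {F G : C ⥤ B} (α : F ⟶ G)
    (K : ChainComplex (Free ℤ C) ℕ) (n : ℕ) :
    HomologicalComplex.homologyMap ((NatTrans.mapHomologicalComplex (karoubiExtensionMap α) _).app
        (((toKaroubi (Free ℤ C)).mapHomologicalComplex _).obj K)) n ≫
        (complexExtensionHomologyIso G K n).hom =
      (complexExtensionHomologyIso F K n).hom ≫ HomologicalComplex.homologyMap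
        ((NatTrans.mapHomologicalComplex (additiveExtension.map α).hom _).app K) n := by
  unfold complexExtensionHomologyIso
  rw [asIso_hom, asIso_hom, ← HomologicalComplex.homologyMap_comp]
  exact (congrArg (fun φ => HomologicalComplex.homologyMap φ n)
    (complexExtension_natTrans α K)).trans (HomologicalComplex.homologyMap_comp _ _ n)

variable {P : ObjectProperty C}

/-- The resolution in the idempotent completion of `ℤC` given by a pseudocubical resolution. -/
def PseudocubicalResolution.normalizedResolution [HasFiniteLimits C] {Y : C}
    (X : PseudocubicalResolution P Y) :
    Resolution (exactClosure (inKaroubiFree P)) ((toKaroubiFree C).obj Y) :=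
  ⟨_, _, X.isResolution_normalized⟩

/-- The resolution in the idempotent completion of `ℤC` given by a resolution in `ℤC`. -/
def Resolution.toKaroubiResolution {Y : Free ℤ C} (S : Resolution (inFree P) Y) :
    Resolution (exactClosure (inKaroubiFree P)) ((toKaroubi (Free ℤ C)).obj Y) where
  complex := ((toKaroubi (Free ℤ C)).mapHomologicalComplex _).obj S.complex
  aug := (toKaroubi (Free ℤ C)).map S.aug
  isResolution :=
    { toIsAcyclic := by
        have h := S.isResolution.toIsAcyclic.map (toKaroubi (Free ℤ C))
        rw [← inKaroubiFree_eq] at h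
        exact h.exactClosure
      mem := fun n => le_exactClosure _ (by
        rw [inKaroubiFree_eq]
        exact ⟨_, S.isResolution.mem n⟩) }

variable [HasFiniteLimits C]

/-- The comparison isomorphism between the cubical derived functors and the relative derived
functors of the additive extension, for given resolutions. -/
def comparisonIso (F : C ⥤ B) {Y : C} (X : PseudocubicalResolution P Y)
    (S : Resolution (inFree P) ((Free.embedding ℤ C).obj Y)) (n : ℕ) :
    (X.toPseudocubicalObject.map F).normalized.homology n ≅
      (((additiveExtensionObj F).mapHomologicalComplex _).obj S.complex).homology n :=
  (normalizedExtensionHomologyIso F X.toPseudocubicalObject n).symm ≪≫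
    Resolution.homologyIso (karoubiExtension F) X.normalizedResolution S.toKaroubiResolution n ≪≫
    complexExtensionHomologyIso F S.complex n

/-- The outer squares are naturality of the isomorphisms `F̃(N(X)) ≅ N(F(X))` and `F̃(S) ≅ F_ad(S)`.
The middle one holds because `N(φ)` and the image of `ψ` lie over the same morphism of the
idempotent completion. -/
lemma comparisonIso_naturality (F : C ⥤ B) {Y Z : C} (f : Y ⟶ Z)
    (X : PseudocubicalResolution P Y) (X' : PseudocubicalResolution P Z)
    (φ : PreHom X.toPseudocubicalObject X'.toPseudocubicalObject)
    (hφ : φ.f 0 ≫ X'.aug = X.aug ≫ f)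
    (S : Resolution (inFree P) ((Free.embedding ℤ C).obj Y))
    (S' : Resolution (inFree P) ((Free.embedding ℤ C).obj Z)) (ψ : S.complex ⟶ S'.complex)
    (hψ : ψ.f 0 ≫ S'.aug = S.aug ≫ (Free.embedding ℤ C).map f) (n : ℕ) :
    homologyNormalizedMap F φ n ≫ (comparisonIso F X' S' n).hom =
      (comparisonIso F X S n).hom ≫ homologyMapOf (additiveExtensionObj F) ψ n := by
  refine naturality_of_squares _ _ _ _ _ _ _
    (homologyMapOf (karoubiExtension F) (normalizedMap (φ.map (toKaroubiFree C))) n)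
    (homologyMapOf (karoubiExtension F)
      (((toKaroubi (Free ℤ C)).mapHomologicalComplex _).map ψ) n) _
    (normalizedExtensionHomologyIso_hom_naturality F φ n) ?_
    (complexExtensionHomologyIso_hom_naturality F ψ n)
  refine Resolution.homologyIso_hom_naturality (karoubiExtension F) ((toKaroubiFree C).map f)
    (R := X.normalizedResolution) (R' := X'.normalizedResolution)
    (S := S.toKaroubiResolution) (S' := S'.toKaroubiResolution) _ ?_ _ ?_ n
  · exact normalizedMap_f_aug (φ.map (toKaroubiFree C)) (((toKaroubiFree C).map_comp _ _).symm.trans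
      ((congrArg (toKaroubiFree C).map hφ).trans ((toKaroubiFree C).map_comp _ _)))
  · exact ((toKaroubi (Free ℤ C)).map_comp _ _).symm.trans
      ((congrArg (toKaroubi (Free ℤ C)).map hψ).trans ((toKaroubi (Free ℤ C)).map_comp _ _))

lemma comparisonIso_natTrans {F G : C ⥤ B} (α : F ⟶ G) {Y : C} (X : PseudocubicalResolution P Y)
    (S : Resolution (inFree P) ((Free.embedding ℤ C).obj Y)) (n : ℕ) :
    HomologicalComplex.homologyMap
        (normalizedMap (PreHom.ofNatTrans α X.toPseudocubicalObject)) n ≫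
        (comparisonIso G X S n).hom =
      (comparisonIso F X S n).hom ≫ HomologicalComplex.homologyMap
        ((NatTrans.mapHomologicalComplex (additiveExtension.map α).hom _).app S.complex) n :=
  naturality_of_squares _ _ _ _ _ _ _ _ _ _
    (normalizedExtensionHomologyIso_hom_natTrans α X.toPseudocubicalObject n)
    (Resolution.homologyIso_hom_natTrans (karoubiExtensionMap α) X.normalizedResolution
      S.toKaroubiResolution n)
    (complexExtensionHomologyIso_hom_natTrans α S.complex n)

/-- The cubical derived functors of `F` are the relative derived functors of the additive
extension of `F`, naturally in `F`. -/
def cubicalDerivedIso (h : ∀ Y : C, possessesResolution (inFree P) ((Free.embedding ℤ C).obj Y))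
    (R : ∀ Y : C, PseudocubicalResolution P Y)
    (S : ∀ A : (possessesResolution (inFree P)).FullSubcategory, Resolution (inFree P) A.obj)
    (n : ℕ) :
    (cubicalDerived R n : (C ⥤ B) ⥤ (C ⥤ B)) ≅
      additiveExtension ⋙ relativeDerived S n ⋙
        (Functor.whiskeringLeft _ _ B).obj
          ((possessesResolution (inFree P)).lift (Free.embedding ℤ C) h) :=
  NatIso.ofComponents
    (fun F => NatIso.ofComponents
      (fun Y => comparisonIso F (R Y) (S ⟨(Free.embedding ℤ C).obj Y, h Y⟩) n)
      (fun {Y Z} f => comparisonIso_naturality F f (R Y) (R Z) _ ((R Y).lift_aug (R Z) f) _ _ _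
        (Resolution.lift_aug _ _ _) n))
    (fun {F G} α => by
      ext Y
      exact comparisonIso_natTrans α (R Y) (S ⟨(Free.embedding ℤ C).obj Y, h Y⟩) n)

end Comparison

end CubicalDerived

end

/-- Naturality in `C` and in `F` is expressed at once by an isomorphism of functors in `F` with
values in functors on `C`. The proof `h` serves to regard `C ⥤ ℤC` as landing in the subcategory
where the relative derived functors are defined. -/
theorem mainTheorem3 {C : Type*} [Category* C] [HasFiniteLimits C] (P : ObjectProperty C)
    (hP : IsProjectiveClass P) (B : Type*) [Category* B] [Abelian B] :
    (∀ (Y : C) (X : PseudocubicalResolution P Y),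
      IsResolution (exactClosure (inKaroubiFree P))
        (X.toPseudocubicalObject.map (toKaroubiFree C)).normalized
        (normalizedAug (X.toPseudocubicalObject.map (toKaroubiFree C))
          ((toKaroubiFree C).map X.aug))) ∧
    (∀ Y : C, Nonempty (PseudocubicalResolution P Y)) ∧
    ∃ h : ∀ Y : C, possessesResolution (inFree P) ((Free.embedding ℤ C).obj Y),
      ∀ (R : ∀ Y : C, PseudocubicalResolution P Y)
        (S : ∀ A : (possessesResolution (inFree P)).FullSubcategory,
          Resolution (inFree P) A.obj) (n : ℕ),
        Nonempty ((cubicalDerived R n : (C ⥤ B) ⥤ (C ⥤ B)) ≅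
          additiveExtension ⋙ relativeDerived S n ⋙
            (Functor.whiskeringLeft _ _ B).obj
              ((possessesResolution (inFree P)).lift (Free.embedding ℤ C) h)) :=
  ⟨fun _ X => X.isResolution_normalized, nonempty_pseudocubicalResolution hP,
    PresimplicialObject.possessesResolution_embedding hP, fun R S n =>
      ⟨cubicalDerivedIso (PresimplicialObject.possessesResolution_embedding hP) R S n⟩⟩
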